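/- **Setting.** Let $\mathcal H$ be a finite set of at least two hypotheses, $\mathcal A$ a finite set of actions, and for $a\in\mathcal A$, $h\in\mathcal H$ let $P_h^a$ be a probability law on a measurable space $\mathcal O$ with density $p_a(\cdot\mid h)$ with respect to a measure $\mu_a$. Assume that all divergences $d_a(h,g)=\mathrm{KL}(P_h^a\|P_g^a)$ are finite and that for all $h\ne g$ there is $a$ with $d_a(h,g)>0$. Fix the true hypothesis $h^*$, put $S_0=\mathcal H\setminus\{h^*\}$, and assume that for some $v>0$ and all $a\in\mathcal A$, $g\in S_0$ the variable $\log\frac{p_a(O\mid h^*)}{p_a(O\mid g)}-d_a(h^*,g)$, $O\sim P_{h^*}^a$, is sub-Gaussian: $\mathbb E\,e^{\lambda(\cdot)}\le e^{\lambda^2v/2}$ for all $\lambda\in\mathbb R$. For $S\subseteq\mathcal H\setminus\{h\}$ let $f_S(w;h)=\min_{g\in S}\sum_a w_a d_a(h,g)$, $D^*(h;S)=\max_{w\in\Delta(\mathcal A)}f_S(w;h)$, $D_0=D^*(h^*;S_0)$ and $L_{S_0}=\max_{g\in S_0}\max_a d_a(h^*,g)$. **Algorithm (Track-and-Stop with elimination).**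 Let $b,c>0$, $\alpha\in(0,1]$, $\delta\in(0,1)$ and $\beta_{\mathrm{elim}}(t,\delta)=\alpha\log\frac1\delta+b\log t+c$. Let $L_t(h)=\sum_{k\le t}\log p_{A_k}(O_k\mid h)$, $Z_t(h,g)=L_t(h)-L_t(g)$, $\hat h(t)\in\arg\max_h L_t(h)$, and let $G_t(i)$ be the set of $g\ne i$ such that $Z_s(i,g)<\beta_{\mathrm{elim}}(s,\delta)$ for all $1\le s\le t$ with $\hat h(s)=i$. Let $u(t)\in\arg\max_{w\in\Delta(\mathcal A)}f_{G_t(\hat h(t))}(w;\hat h(t))$, let $\tilde u(t)$ be an $\ell_\infty$-projection of $u(t)$ on $\{w\in\Delta(\mathcal A): w_a\ge\varepsilon_t\ \forall a\}$ with $\varepsilon_t=\frac12(|\mathcal A|^2+t)^{-1/2}$, and let C-Tracking select $A_{t+1}\in\arg\max_a\bigl(\sum_{s=0}^t\tilde u_a(s)-N_a(t)\bigr)$, where $N_a(t)$ is the number of selections of $a$ up to time $t$; given the past, $O_{t+1}\sim P_{h^*}^{A_{t+1}}$. Ties are broken arbitrarily. The algorithm stops at $\tau=\inf\{t\ge1:G_t(\hat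 h(t))=\emptyset\}$ and outputs $\hat h(\tau)$; the trajectory is continued by the same rules after $\tau$ (with an arbitrary $u(t)\in\Delta(\mathcal A)$ when $G_t(\hat h(t))=\emptyset$). **Events.** A chain is a sequence $\sigma=(S_0\supsetneq S_1\supsetneq\dots\supsetneq S_m=\emptyset)$; its chain event $\mathcal E_\sigma$ says that $\tau<\infty$, $\hat h(\tau)=h^*$, and there are times $0=T_0<T_1<\dots<T_m=\tau$ with $G_t(h^*)=S_k$ for $T_k\le t<T_{k+1}$, $0\le k<m$, and $G_\tau(h^*)=\emptyset$. Let $\mathcal E_{\mathrm{corr}}=\bigcup_\sigma\mathcal E_\sigma$ and $R_{\mathrm{comp}}(\delta)=\mathbb E[\tau\mathbf 1_{\mathcal E_{\mathrm{corr}}^c}]\in[0,\infty]$. For $\kappa,\eta>0$ let $T_{\mathrm{ch}}=\inf\{s\ge1:\hat h(r)=h^*\ \forall r\ge s\}$, $M_s^g=\sum_{r\le s}\bigl(\log\frac{p_{A_r}(O_r\mid h^*)}{p_{A_r}(O_r\mid g)}-d_{A_r}(h^*,g)\bigr)$, $$\widetilde{\mathcal G}_t=\{T_{\mathrm{ch}}\le\lceil\kappa\log^2t\rceil\}\cap\{\forall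 g\in S_0,\ \forall s\le t:\ |M_s^g|\le\eta\sqrt{s\log(e+t)}\},\qquad C_{\widetilde G}=\sum_{t\ge3}\Pr(\widetilde{\mathcal G}_t^c),$$ $\overline m(t)=1+\kappa\log^2(e+t)$, $T_{\mathrm{warm}}=\min\{t\ge3:\overline m(t)\le t\}$, $$\Gamma(t)=tD_0-D_0\overline m(t)-2|\mathcal A|^2L_{S_0}\sqrt t-\eta\sqrt{t\log(e+t)},$$ $$\widetilde T(\delta)=\inf\{T\ge T_{\mathrm{warm}}:\ \beta_{\mathrm{elim}}(t,\delta)\le\Gamma(t)\ \ \forall t\ge T\}.$$ **Proposition.** There is $\kappa_0>0$ such that for all $\kappa\ge\kappa_0$, $\eta\ge\sqrt{10v}$ and $b,c>0$ there are finite constants $\widetilde K,\bar C$, independent of $\delta$ and $\alpha$, such that for every $\alpha\in(0,1]$ and every $\delta\in(0,1)$ $$\widetilde T(\delta)\le\widetilde K\bigl(1+\log\tfrac1\delta\bigr),\qquad C_{\widetilde G}\le\bar C,\qquad R_{\mathrm{comp}}(\delta)\le\widetilde T(\delta)\cdot\Pr(\mathcal E_{\mathrm{corr}}^c)+C_{\widetilde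 G}.$$ Moreover, for every $\alpha\in(0,1]$ there is a $\delta$-independent constant $\bar R_{\mathrm{comp}}<\infty$ such that $R_{\mathrm{comp}}(\delta)\le\bar R_{\mathrm{comp}}$ for every $\delta\in(0,1)$. -/

import Mathlib

open MeasureTheory ProbabilityTheory Filter Set
open scoped ENNReal NNReal

namespace ElimTaS

noncomputable section

/-! ### The sensing model -/

/-- An active multi-hypothesis sensing model with hypotheses `H`, actions `A` and observation
space `O`: for each action `a` a dominating measure `base a` and densities `p a h` of the
observation laws with respect to it.  The Kullback-Leibler divergences between the observation
laws are finite, so that log-likelihood ratios and information rates are real numbers. -/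
structure SensingModel (H A O : Type*) [MeasurableSpace O] where
  base : A → Measure O
  p : A → H → O → ℝ
  measurable_p : ∀ a h, Measurable (p a h)
  p_nonneg : ∀ a h o, 0 ≤ p a h o
  isProb : ∀ a h,
    IsProbabilityMeasure ((base a).withDensity fun o => ENNReal.ofReal (p a h o))
  klDiv_ne_top : ∀ a h g,
    InformationTheory.klDiv ((base a).withDensity fun o => ENNReal.ofReal (p a h o))
      ((base a).withDensity fun o => ENNReal.ofReal (p a g o)) ≠ ∞

section Model

variable {H A O : Type*} [MeasurableSpace O]

/-- The law `P_h^a` of an observation under action `a` when the hypothesis `h` is true. -/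
def SensingModel.law (M : SensingModel H A O) (a : A) (h : H) : Measure O :=
  (M.base a).withDensity fun o => ENNReal.ofReal (M.p a h o)

/-- The action-wise divergence `d_a(h,g) = KL(P_h^a ‖ P_g^a)`. -/
def SensingModel.d (M : SensingModel H A O) (a : A) (h g : H) : ℝ :=
  (InformationTheory.klDiv (M.law a h) (M.law a g)).toReal

/-- The log-likelihood ratio `log (p_a(o|h) / p_a(o|g))` of one observation.  (All densities are
positive almost surely under each of the laws, because the divergences are finite.) -/
def SensingModel.logRatio (M : SensingModel H A O) (a : A) (h g : H) (o : O) : ℝ :=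
  Real.log (M.p a h o) - Real.log (M.p a g o)

/-- Any two distinct hypotheses are distinguished by some action. -/
def SensingModel.Identifiable (M : SensingModel H A O) : Prop :=
  ∀ h g : H, h ≠ g → ∃ a : A, 0 < M.d a h g

/-- Under the true hypothesis `h`, the centered log-likelihood ratio against any other hypothesis
is sub-Gaussian with parameter `v`, for every action. -/
def SensingModel.SubGaussian (M : SensingModel H A O) (h : H) (v : ℝ≥0) : Prop :=
  ∀ (a : A) (g : H), g ≠ h →
    HasSubgaussianMGF (fun o => M.logRatio a h g o - M.d a h g) v (M.law a h)

/-! ### Oracle allocations -/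

variable [Fintype A]

/-- The worst-case information rate `f_S(w;h) = min_{g ∈ S} ∑_a w_a d_a(h,g)`, for nonempty `S`.
(For `S = ∅` it is constantly `0`.) -/
def SensingModel.f (M : SensingModel H A O) (h : H) (S : Set H) (w : A → ℝ) : ℝ :=
  ⨅ g : S, ∑ a, w a * M.d a h g

/-- The oracle information rate `D^*(h;S) = max_{w ∈ Δ(A)} f_S(w;h)`. -/
def SensingModel.Dstar (M : SensingModel H A O) (h : H) (S : Set H) : ℝ :=
  ⨆ w : stdSimplex ℝ A, M.f h S w

/-- `w` is an oracle allocation: `w ∈ argmax_{w ∈ Δ(A)} f_S(w;h)`.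
(For `S = ∅` this says only that `w ∈ Δ(A)`.) -/
def SensingModel.IsOracle (M : SensingModel H A O) (h : H) (S : Set H) (w : A → ℝ) : Prop :=
  w ∈ stdSimplex ℝ A ∧ ∀ w' ∈ stdSimplex ℝ A, M.f h S w' ≤ M.f h S w

/-- The Lipschitz constant `L_S = max_{g ∈ S} max_a d_a(h,g)`. -/
def SensingModel.lip (M : SensingModel H A O) (h : H) (S : Set H) : ℝ :=
  ⨆ g : S, ⨆ a : A, M.d a h g

end Model

/-! ### Trajectory functionals

A trajectory is `x : ℕ → A`, `y : ℕ → O` with `x k = A_{k+1}`, `y k = O_{k+1}`, together with the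
sequence of champions `c : ℕ → H`, `c t = ĥ(t)`. -/

section Path

variable {H A O : Type*} [MeasurableSpace O]

/-- The cumulative log-likelihood `L_t(h)`. -/
def logLik (M : SensingModel H A O) (x : ℕ → A) (y : ℕ → O) (t : ℕ) (h : H) : ℝ :=
  ∑ k ∈ Finset.range t, Real.log (M.p (x k) h (y k))

/-- The pairwise log-likelihood ratio `Z_t(h,g) = L_t(h) - L_t(g)`. -/
def Z (M : SensingModel H A O) (x : ℕ → A) (y : ℕ → O) (t : ℕ) (h g : H) : ℝ :=
  logLik M x y t h - logLik M x y t g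

/-- The process `M_t^g = ∑_{r ≤ t} (log (p_{A_r}(O_r|h) / p_{A_r}(O_r|g)) - d_{A_r}(h,g))`. -/
def mart (M : SensingModel H A O) (h : H) (x : ℕ → A) (y : ℕ → O) (t : ℕ) (g : H) : ℝ :=
  ∑ k ∈ Finset.range t, (M.logRatio (x k) h g (y k) - M.d (x k) h g)

/-- The number `N_a(t)` of selections of the action `a` up to time `t`. -/
def count [DecidableEq A] (x : ℕ → A) (t : ℕ) (a : A) : ℕ :=
  ((Finset.range t).filter fun k => x k = a).card

/-- The elimination threshold `β_elim(t,δ) = α log(1/δ) + b log t + c`. -/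
def betaElim (b c α δ : ℝ) (t : ℕ) : ℝ :=
  α * Real.log (1 / δ) + (b * Real.log t + c)

/-- The active-opponent set `G_t(i)`: the opponents of `i` whose elimination threshold has not
been reached at any time `1 ≤ s ≤ t` at which `i` was the champion. -/
def activeSet (M : SensingModel H A O) (b c α δ : ℝ) (x : ℕ → A) (y : ℕ → O) (champ : ℕ → H)
    (t : ℕ) (i : H) : Set H :=
  {g | g ≠ i ∧ ∀ s : ℕ, 1 ≤ s → s ≤ t → champ s = i → Z M x y s i g < betaElim b c α δ s}

/-- Initialisation of the active-opponent sets. -/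
theorem activeSet_zero (M : SensingModel H A O) (b c α δ : ℝ) (x : ℕ → A) (y : ℕ → O)
    (champ : ℕ → H) (i : H) : activeSet M b c α δ x y champ 0 i = {i}ᶜ := by
  ext g
  simp only [activeSet, mem_ofPred_eq, mem_compl_iff, mem_singleton_iff]
  exact ⟨fun hg => hg.1, fun hg => ⟨hg, fun s h1 h2 => absurd h1 (by omega)⟩⟩

/-- Update of the active-opponent set of the current champion. -/
theorem activeSet_succ_champ (M : SensingModel H A O) (b c α δ : ℝ) (x : ℕ → A) (y : ℕ → O)
    (champ : ℕ → H) (t : ℕ) (i : H) (hi : champ (t + 1) = i) :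
    activeSet M b c α δ x y champ (t + 1) i = activeSet M b c α δ x y champ t i \
      {g | betaElim b c α δ (t + 1) ≤ Z M x y (t + 1) i g} := by
  ext g
  simp only [activeSet, mem_ofPred_eq, Set.mem_sdiff, not_le]
  constructor
  · rintro ⟨h1, h2⟩
    exact ⟨⟨h1, fun s a b => h2 s a (by omega)⟩, by simpa using h2 (t + 1) (by omega) le_rfl hi⟩
  · rintro ⟨⟨h1, h2⟩, h3⟩
    refine ⟨h1, fun s a b hs => ?_⟩
    rcases Nat.lt_or_ge t s with h | h
    · obtain rfl : s = t + 1 := by omega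
      simpa using h3
    · exact h2 s a h hs

/-- The active-opponent sets of the other candidates do not change. -/
theorem activeSet_succ_other (M : SensingModel H A O) (b c α δ : ℝ) (x : ℕ → A) (y : ℕ → O)
    (champ : ℕ → H) (t : ℕ) (i : H) (hi : champ (t + 1) ≠ i) :
    activeSet M b c α δ x y champ (t + 1) i = activeSet M b c α δ x y champ t i := by
  ext g
  simp only [activeSet, mem_ofPred_eq]
  refine and_congr_right fun _ => ⟨fun h2 s a b => h2 s a (by omega), fun h2 s a b hs => ?_⟩
  rcases Nat.lt_or_ge t s with h | h
  · obtain rfl : s = t + 1 := by omega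
    exact absurd hs hi
  · exact h2 s a h hs

end Path

/-! ### C-Tracking -/

section Tracking

variable {A : Type*} [Fintype A]

/-- The truncated simplex `{w ∈ [ε,1]^A : ∑_a w_a = 1}`. -/
def truncSimplex (A : Type*) [Fintype A] (ε : ℝ) : Set (A → ℝ) :=
  {w | w ∈ stdSimplex ℝ A ∧ ∀ a, ε ≤ w a}

/-- `w` is a projection of `u` on the truncated simplex in the maximum norm. -/
def IsTruncProj (ε : ℝ) (u w : A → ℝ) : Prop :=
  w ∈ truncSimplex A ε ∧ ∀ w' ∈ truncSimplex A ε, ‖w - u‖ ≤ ‖w' - u‖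

/-- The exploration rate `ε_t = (|A|² + t)^{-1/2} / 2` of C-Tracking. -/
def explRate (A : Type*) [Fintype A] (t : ℕ) : ℝ :=
  1 / (2 * Real.sqrt ((Fintype.card A : ℝ) ^ 2 + t))

end Tracking

/-! ### Track-and-Stop with elimination -/

section Algorithm

variable {H A O : Type*} [MeasurableSpace O] [Fintype A] [DecidableEq A]

/-- A run, under the true hypothesis `h`, of Track-and-Stop with elimination with parameters
`b c α δ`, on the probability space `(Ω, μ)`.

`act t` is `A_{t+1}` and `obs t` is `O_{t+1}`; `ℱ t` is the information available after `t`
rounds (the history, and possibly the randomness used to break ties), and given `ℱ t` the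
observation `O_{t+1}` is drawn from `P_h^{A_{t+1}}`.  `target t` is the oracle allocation `u(t)`
of the champion against its active opponents; by C-Tracking, the action `A_{t+1}` has the largest
deficit with respect to the accumulated targets, each of them projected on a truncated simplex
to force exploration.  All ties are broken arbitrarily.  The trajectory is continued
by the same rules after the algorithm has stopped (with an arbitrary target if the champion has no
active opponent). -/
structure Run (M : SensingModel H A O) (h : H) (b c α δ : ℝ) {Ω : Type*} [mΩ : MeasurableSpace Ω]
    (μ : Measure Ω) where
  ℱ : Filtration ℕ mΩ
  champ : ℕ → Ω → H
  act : ℕ → Ω → A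
  obs : ℕ → Ω → O
  target : ℕ → Ω → A → ℝ
  explored : ℕ → Ω → A → ℝ
  measurable_champ : ∀ t i, MeasurableSet[ℱ t] {ω | champ t ω = i}
  measurable_act : ∀ t a, MeasurableSet[ℱ t] {ω | act t ω = a}
  measurable_obs : ∀ t, Measurable[ℱ (t + 1)] (obs t)
  obs_law : ∀ (t : ℕ) (F : Set Ω), MeasurableSet[ℱ t] F → ∀ (a : A) (B : Set O),
    MeasurableSet B →
      μ (F ∩ {ω | act t ω = a} ∩ {ω | obs t ω ∈ B}) = μ (F ∩ {ω | act t ω = a}) * M.law a h B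
  champ_max : ∀ t ω i, logLik M (fun k => act k ω) (fun k => obs k ω) t i ≤
    logLik M (fun k => act k ω) (fun k => obs k ω) t (champ t ω)
  target_oracle : ∀ t ω, M.IsOracle (champ t ω)
    (activeSet M b c α δ (fun k => act k ω) (fun k => obs k ω) (fun k => champ k ω) t
      (champ t ω)) (target t ω)
  explored_proj : ∀ t ω, IsTruncProj (explRate A t) (target t ω) (explored t ω)
  act_tracks : ∀ t ω a,
    (∑ s ∈ Finset.range (t + 1), explored s ω a) - count (fun k => act k ω) t a ≤
      (∑ s ∈ Finset.range (t + 1), explored s ω (act t ω)) -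
        count (fun k => act k ω) t (act t ω)

/-- An elimination chain `S_0 ⊃ S_1 ⊃ ⋯ ⊃ S_len = ∅` with `S_0 = H \ {h}`. -/
structure ElimChain {H : Type*} (h : H) where
  len : ℕ
  sets : Fin (len + 1) → Set H
  sets_zero : sets 0 = {h}ᶜ
  sets_last : sets (Fin.last len) = ∅
  strictAnti : StrictAnti sets

namespace Run

variable {M : SensingModel H A O} {h : H} {b c α δ : ℝ} {Ω : Type*} [MeasurableSpace Ω]
  {μ : Measure Ω}

/-- The active-opponent set `G_t(i)` along the run. -/
def G (R : Run M h b c α δ μ) (t : ℕ) (i : H) (ω : Ω) : Set H :=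
  activeSet M b c α δ (fun k => R.act k ω) (fun k => R.obs k ω) (fun k => R.champ k ω) t i

/-- The stopping time `τ`: the first round at which the champion has no active opponent left
(`⊤` if there is none). -/
def tau (R : Run M h b c α δ μ) (ω : Ω) : ℕ∞ :=
  sInf ((fun n : ℕ => (n : ℕ∞)) '' {t : ℕ | 1 ≤ t ∧ R.G t (R.champ t ω) ω = ∅})

/-- The chain event: the run stops with output `h`, and there are times
`0 = T_0 < T_1 < ⋯ < T_len = τ` such that `G_t(h) = S_k` from the round `T_k` of the `k`-th
transition until just before the next one. -/
def chainEvent (R : Run M h b c α δ μ) (σ : ElimChain h) : Set Ω :=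
  {ω | ∃ n : ℕ, R.tau ω = n ∧ R.champ n ω = h ∧ R.G n h ω = ∅ ∧
    ∃ T : Fin (σ.len + 1) → ℕ, StrictMono T ∧ T 0 = 0 ∧ T (Fin.last σ.len) = n ∧
      ∀ (k : Fin σ.len) (t : ℕ), T k.castSucc ≤ t → t < T k.succ →
        R.G t h ω = σ.sets k.castSucc}

/-- The correct-elimination event, the union of all chain events. -/
def corrEvent (R : Run M h b c α δ μ) : Set Ω :=
  ⋃ σ : ElimChain h, R.chainEvent σ

/-- `R_comp(δ) = E[τ · 1_{E_corr^c}]`, as an extended nonnegative number. -/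
def Rcomp (R : Run M h b c α δ μ) : ℝ≥0∞ :=
  ∫⁻ ω in R.corrEventᶜ, (R.tau ω : ℝ≥0∞) ∂μ

/-- The champion stabilization time `T_ch` (`⊤` if the champion does not stabilize at `h`). -/
def Tch (R : Run M h b c α δ μ) (ω : Ω) : ℕ∞ :=
  sInf ((fun n : ℕ => (n : ℕ∞)) '' {s : ℕ | 1 ≤ s ∧ ∀ r ≥ s, R.champ r ω = h})

/-- The crude good event at time `t`: the champion has stabilized by time `⌈κ log² t⌉`, and
`|M_s^g| ≤ η √(s log(e+t))` for all opponents `g` of `h` and all `s ≤ t`. -/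
def goodEvent (R : Run M h b c α δ μ) (κ η : ℝ) (t : ℕ) : Set Ω :=
  {ω | R.Tch ω ≤ (⌈κ * Real.log t ^ 2⌉₊ : ℕ∞)} ∩
  {ω | ∀ g : H, g ≠ h → ∀ s ≤ t,
    |mart M h (fun k => R.act k ω) (fun k => R.obs k ω) s g| ≤
      η * Real.sqrt (s * Real.log (Real.exp 1 + t))}

/-- `C_G = ∑_{t ≥ 3} Pr(G_t^c)` for the crude good events `G_t`. -/
def Cgood (R : Run M h b c α δ μ) (κ η : ℝ) : ℝ≥0∞ :=
  ∑' t : ℕ, μ (R.goodEvent κ η (t + 3))ᶜ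

end Run

end Algorithm

/-! ### The crude certificate -/

section Certificate

variable {H A O : Type*} [MeasurableSpace O] [Fintype A]

/-- The envelope `1 + κ log²(e+t)` of the stabilization horizon. -/
def mBar (κ : ℝ) (t : ℕ) : ℝ := 1 + κ * Real.log (Real.exp 1 + t) ^ 2

/-- The warm-up time `min {t ≥ 3 : 1 + κ log²(e+t) ≤ t}`. -/
def Twarm (κ : ℝ) : ℕ := sInf {t : ℕ | 3 ≤ t ∧ mBar κ t ≤ t}

/-- The evidence lower bound
`Γ(t) = t D_0 - D_0 (1 + κ log²(e+t)) - L_{S_0} c_tr √t - η √(t log(e+t))`, where `S_0 = H \ {h}`,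
`D_0 = D^*(h;S_0)` and `c_tr = 2|A|²`. -/
def Gam (M : SensingModel H A O) (h : H) (κ η : ℝ) (t : ℕ) : ℝ :=
  t * M.Dstar h {h}ᶜ - M.Dstar h {h}ᶜ * mBar κ t
    - M.lip h {h}ᶜ * (2 * (Fintype.card A : ℝ) ^ 2) * Real.sqrt t
    - η * Real.sqrt (t * Real.log (Real.exp 1 + t))

/-- The crude certificate `inf {T ≥ T_warm : ∀ t ≥ T, β_elim(t,δ) ≤ Γ(t)}` (`⊤` if there is no
such `T`). -/
def Ttilde (M : SensingModel H A O) (h : H) (b c α δ κ η : ℝ) : ℕ∞ :=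
  sInf ((fun n : ℕ => (n : ℕ∞)) ''
    {T : ℕ | Twarm κ ≤ T ∧ ∀ t ≥ T, betaElim b c α δ t ≤ Gam M h κ η t})

end Certificate

end

end ElimTaS

namespace ElimTaS

/-! ### Deterministic analysis of C-Tracking -/

section Tracking

variable {A : Type*} [DecidableEq A]

/-! On the good event at time `t` the champion is `h` from round `⌈κ log² t⌉` on. An opponent `g`
active at `t` was active at all earlier times, so every target in that period is optimal against a
subset of `S_0` containing `g` and gains information against `g` at rate at least `D_0`
(`IsOracle.Dstar_le`). Tracking loses at most `2|A|² L √t` and the centred sum at most `η √(t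
log(e+t))`, hence `Z_t(h,g) ≥ Γ(t)`. Once the threshold is below `Γ(t)` no opponent can survive, and
`τ ≤ t` (`tau_le_of_mem_goodEvent`). Summing the tails of `τ` over the complement of the correct
event gives the bound on `R_comp` (`Rcomp_le`). The certificate is of order `1 + log(1/δ)` because
`Γ` grows linearly.

The bound on `C_G` rests on Ville's inequality (`measure_exists_le_sum_le`). Forced exploration
samples every action about `√t` times, so a wrong champion has probability of order `exp(-r √t)`.
From round `κ log² t` on this sums to order `t^{-2}` when `κ` is large, and sub-Gaussian tails
control the fluctuations.

For the bound uniform in `δ`, stopping with output `h` always follows a chain (`mem_corrEvent`) and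
`τ` is almost surely finite. The correct event can therefore fail only if `h` itself is eliminated,
with probability at most `|H| δ^α`, which absorbs the factor `1 + log(1/δ)`. -/

theorem count_succ (x : ℕ → A) (t : ℕ) (a : A) :
    count x (t + 1) a = count x t a + if x t = a then 1 else 0 := by
  unfold count
  rw [Finset.range_add_one, Finset.filter_insert]
  split_ifs with h
  · rw [Finset.card_insert_of_notMem (by simp)]
  · rfl

theorem sum_range_comp_eq_sum_count [Fintype A] (x : ℕ → A) (φ : A → ℝ) (t : ℕ) :
    ∑ k ∈ Finset.range t, φ (x k) = ∑ a, (count x t a : ℝ) * φ a := by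
  induction t with
  | zero => simp [count]
  | succ t ih =>
    simp [Finset.sum_range_succ, ih, count_succ, add_mul, Finset.sum_add_distrib]

theorem sum_count [Fintype A] (x : ℕ → A) (t : ℕ) : ∑ a, (count x t a : ℝ) = t := by
  simpa using (sum_range_comp_eq_sum_count x (fun _ => 1) t).symm

/-- Greedy tracking keeps all counts close to the accumulated targets. -/
theorem abs_count_sub_sum_le [Fintype A] {x : ℕ → A} {w : ℕ → A → ℝ}
    (hw : ∀ t, w t ∈ stdSimplex ℝ A)
    (hx : ∀ t a, (∑ s ∈ Finset.range (t + 1), w s a) - count x t a ≤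
      (∑ s ∈ Finset.range (t + 1), w s (x t)) - count x t (x t)) (t : ℕ) (a : A) :
    |(count x t a : ℝ) - ∑ s ∈ Finset.range t, w s a| ≤ Fintype.card A := by
  have htot : ∀ t, ∑ a, ∑ s ∈ Finset.range t, w s a = t := by
    intro t
    rw [Finset.sum_comm, Finset.sum_congr rfl fun s _ => (hw s).2]
    simp
  have hlow : ∀ t a, (count x t a : ℝ) - ∑ s ∈ Finset.range t, w s a ≤ 1 := by
    intro t
    induction t with
    | zero => simp [count]
    | succ t ih =>
      intro a
      rw [count_succ]
      split_ifs with h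
      · subst h
        -- The deficits sum to `(t + 1) - t = 1`, so the largest one, that of the selected action,
        -- cannot be negative.
        have hpos : 0 ≤ (∑ s ∈ Finset.range (t + 1), w s (x t)) - count x t (x t) := by
          by_contra! hneg
          have h1 : ∑ a, ((∑ s ∈ Finset.range (t + 1), w s a) - (count x t a : ℝ)) ≤ 0 :=
            Finset.sum_nonpos fun a _ => (hx t a).trans hneg.le
          rw [Finset.sum_sub_distrib, htot, sum_count] at h1
          push_cast at h1
          linarith
        push_cast
        linarith
      · rw [Finset.sum_range_succ]
        have := ih a
        have := (hw t).1 a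
        push_cast
        linarith
  have hK : (1 : ℝ) ≤ Fintype.card A := by
    exact_mod_cast Fintype.card_pos_iff.2 ⟨a⟩
  rw [abs_le]
  refine ⟨?_, (hlow t a).trans hK⟩
  have hsum : ∑ b, ((count x t b : ℝ) - ∑ s ∈ Finset.range t, w s b) = 0 := by
    rw [Finset.sum_sub_distrib, htot, sum_count, sub_self]
  rw [← Finset.add_sum_erase _ _ (Finset.mem_univ a)] at hsum
  -- The surpluses sum to zero, so a deficit of `a` equals the total surplus of the other actions,
  -- each at most `1`.
  have h2 : ∑ b ∈ Finset.univ.erase a, ((count x t b : ℝ) - ∑ s ∈ Finset.range t, w s b) ≤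
      ∑ b ∈ Finset.univ.erase a, (1 : ℝ) := Finset.sum_le_sum fun b _ => hlow t b
  have h3 : ∑ b ∈ Finset.univ.erase a, (1 : ℝ) ≤ Fintype.card A := by
    rw [Finset.sum_const, nsmul_one]
    exact_mod_cast Finset.card_le_univ _
  linarith

/-- The projection on the truncated simplex moves a point by at most `|A| ε`. -/
theorem IsTruncProj.abs_sub_le {A : Type*} [Fintype A] {ε : ℝ} {u w : A → ℝ}
    (h : IsTruncProj ε u w) (hu : u ∈ stdSimplex ℝ A) (hε : 0 ≤ ε)
    (hKε : Fintype.card A * ε ≤ 1) (a : A) : |w a - u a| ≤ Fintype.card A * ε := by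
  have hK : (1 : ℝ) ≤ Fintype.card A := by
    exact_mod_cast Fintype.card_pos_iff.2 ⟨a⟩
  set K : ℝ := (Fintype.card A : ℝ) with hKdef
  -- A feasible competitor: the mixture of `u` with the uniform allocation, with weight `Kε` on the
  -- latter.
  have hmem : (fun b => (1 - K * ε) * u b + ε) ∈ truncSimplex A ε := by
    refine ⟨⟨fun b => ?_, ?_⟩, fun b => ?_⟩
    · have := mul_nonneg (sub_nonneg.2 hKε) (hu.1 b)
      positivity
    · rw [Finset.sum_add_distrib, ← Finset.mul_sum, hu.2, Finset.sum_const, nsmul_eq_mul,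
        Finset.card_univ]
      ring
    · have := mul_nonneg (sub_nonneg.2 hKε) (hu.1 b)
      linarith
  have h1 : ‖w - u‖ ≤ K * ε := by
    refine (h.2 _ hmem).trans ((pi_norm_le_iff_of_nonneg (by positivity)).2 fun b => ?_)
    have hb0 := hu.1 b
    have hb1 : u b ≤ 1 := by
      rw [← hu.2]
      exact Finset.single_le_sum (fun c _ => hu.1 c) (Finset.mem_univ b)
    have e : ((fun b => (1 - K * ε) * u b + ε) - u) b = ε * (1 - K * u b) := by
      simp only [Pi.sub_apply]
      ring
    rw [e, Real.norm_eq_abs, abs_mul, abs_of_nonneg hε, mul_comm K ε]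
    refine mul_le_mul_of_nonneg_left ?_ hε
    rw [abs_le]
    constructor <;> nlinarith
  exact (norm_le_pi_norm (w - u) a).trans h1

theorem explRate_nonneg (A : Type*) [Fintype A] (t : ℕ) : 0 ≤ explRate A t := by
  unfold explRate
  positivity

theorem card_mul_explRate_le (A : Type*) [Fintype A] [Nonempty A] (t : ℕ) :
    Fintype.card A * explRate A t ≤ 1 := by
  have hK : (0 : ℝ) < Fintype.card A := by exact_mod_cast Fintype.card_pos
  have h : (Fintype.card A : ℝ) ≤ Real.sqrt ((Fintype.card A : ℝ) ^ 2 + t) :=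
    Real.le_sqrt_of_sq_le (by have := t.cast_nonneg (α := ℝ); linarith)
  unfold explRate
  rw [mul_one_div, div_le_one (by positivity)]
  linarith

/-- Since `|A|² ≥ 1`, each term is at most `√(t+1) - √t`, and the sum telescopes. -/
theorem sum_explRate_le (A : Type*) [Fintype A] [Nonempty A] (t : ℕ) :
    ∑ s ∈ Finset.range t, explRate A s ≤ Real.sqrt t := by
  induction t with
  | zero => simp
  | succ t ih =>
    rw [Finset.sum_range_succ]
    have hK : (1 : ℝ) ≤ Fintype.card A := by exact_mod_cast Fintype.card_pos
    have ht : (0 : ℝ) ≤ t := t.cast_nonneg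
    have h1 : explRate A t ≤ 1 / (2 * Real.sqrt ((t : ℝ) + 1)) := by
      unfold explRate
      have : Real.sqrt ((t : ℝ) + 1) ≤ Real.sqrt ((Fintype.card A : ℝ) ^ 2 + t) :=
        Real.sqrt_le_sqrt (by nlinarith)
      gcongr
    have h2 : 1 / (2 * Real.sqrt ((t : ℝ) + 1)) ≤ Real.sqrt ((t : ℝ) + 1) - Real.sqrt t := by
      rw [div_le_iff₀ (by positivity)]
      nlinarith [Real.sq_sqrt ht, Real.sq_sqrt (by positivity : (0 : ℝ) ≤ (t : ℝ) + 1),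
        sq_nonneg (Real.sqrt ((t : ℝ) + 1) - Real.sqrt t)]
    push_cast
    linarith

/-- Telescoping from below: `√(x+1) - √x ≤ 1/(2√x)` at `x = |A|² + t`, starting from `√(|A|²) =
|A|`. -/
theorem le_sum_explRate (A : Type*) [Fintype A] [Nonempty A] (t : ℕ) :
    Real.sqrt t - Fintype.card A ≤ ∑ s ∈ Finset.range t, explRate A s := by
  have hK : (1 : ℝ) ≤ Fintype.card A := by exact_mod_cast Fintype.card_pos
  have key : Real.sqrt ((Fintype.card A : ℝ) ^ 2 + t) - Fintype.card A ≤
      ∑ s ∈ Finset.range t, explRate A s := by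
    induction t with
    | zero => simp
    | succ t ih =>
      rw [Finset.sum_range_succ]
      have ht : (0 : ℝ) ≤ t := t.cast_nonneg
      set x : ℝ := (Fintype.card A : ℝ) ^ 2 + t with hx
      have hx0 : 0 < x := by positivity
      have h2 : Real.sqrt (x + 1) - Real.sqrt x ≤ explRate A t := by
        unfold explRate
        rw [← hx, le_div_iff₀ (by positivity)]
        nlinarith [Real.sq_sqrt hx0.le, Real.sq_sqrt (by positivity : (0 : ℝ) ≤ x + 1),
          sq_nonneg (Real.sqrt (x + 1) - Real.sqrt x)]
      have e : (Fintype.card A : ℝ) ^ 2 + ((t + 1 : ℕ) : ℝ) = x + 1 := by push_cast; ring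
      rw [e]
      linarith
  have : Real.sqrt t ≤ Real.sqrt ((Fintype.card A : ℝ) ^ 2 + t) :=
    Real.sqrt_le_sqrt (by nlinarith)
  linarith

end Tracking

namespace Run

variable {H A O : Type*} [MeasurableSpace O] [Fintype A] [DecidableEq A]
  {M : SensingModel H A O} {h : H} {b c α δ : ℝ} {Ω : Type*} [MeasurableSpace Ω] {μ : Measure Ω}

theorem abs_count_sub_explored_le (R : Run M h b c α δ μ) (ω : Ω) (t : ℕ) (a : A) :
    |(count (fun k => R.act k ω) t a : ℝ) - ∑ s ∈ Finset.range t, R.explored s ω a| ≤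
      Fintype.card A :=
  abs_count_sub_sum_le (x := fun k => R.act k ω) (w := fun s => R.explored s ω)
    (fun s => (R.explored_proj s ω).1.1) (fun s a => R.act_tracks s ω a) t a

/-- Forced exploration. -/
theorem sqrt_sub_le_count (R : Run M h b c α δ μ) (ω : Ω) (t : ℕ) (a : A) :
    Real.sqrt t - 2 * Fintype.card A ≤ count (fun k => R.act k ω) t a := by
  have : Nonempty A := ⟨a⟩
  have h1 := (abs_le.1 (R.abs_count_sub_explored_le ω t a)).1
  have h2 : ∑ s ∈ Finset.range t, explRate A s ≤ ∑ s ∈ Finset.range t, R.explored s ω a :=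
    Finset.sum_le_sum fun s _ => (R.explored_proj s ω).1.2 a
  have h3 := le_sum_explRate A t
  linarith

/-- Greedy tracking costs `|A|`, the projections cost `|A| ∑ ε_s ≤ |A| √t`, and `t ≥ 1` merges the
two. Summation over the actions later yields the constant `2|A|²` of `Γ`. -/
theorem abs_count_sub_target_le (R : Run M h b c α δ μ) (ω : Ω) {t : ℕ} (ht : 1 ≤ t) (a : A) :
    |(count (fun k => R.act k ω) t a : ℝ) - ∑ s ∈ Finset.range t, R.target s ω a| ≤
      2 * Fintype.card A * Real.sqrt t := by
  have : Nonempty A := ⟨a⟩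
  have h1 := R.abs_count_sub_explored_le ω t a
  have h2 : |∑ s ∈ Finset.range t, R.explored s ω a - ∑ s ∈ Finset.range t, R.target s ω a| ≤
      Fintype.card A * Real.sqrt t := by
    rw [← Finset.sum_sub_distrib]
    refine (Finset.abs_sum_le_sum_abs _ _).trans ?_
    refine (Finset.sum_le_sum fun s _ => (R.explored_proj s ω).abs_sub_le
      (R.target_oracle s ω).1 (explRate_nonneg A s) (card_mul_explRate_le A s) a).trans ?_
    rw [← Finset.mul_sum]
    exact mul_le_mul_of_nonneg_left (sum_explRate_le A t) (by positivity)
  have h3 : (Fintype.card A : ℝ) ≤ Fintype.card A * Real.sqrt t :=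
    le_mul_of_one_le_right (by positivity) (Real.one_le_sqrt.2 (by exact_mod_cast ht))
  have h4 := abs_sub_le (count (fun k => R.act k ω) t a : ℝ)
    (∑ s ∈ Finset.range t, R.explored s ω a) (∑ s ∈ Finset.range t, R.target s ω a)
  linarith

end Run

end ElimTaS

namespace ElimTaS

/-! ### Exponential moments of the log-likelihood ratios -/

section Model

variable {H A O : Type*} [MeasurableSpace O]

namespace SensingModel

instance (M : SensingModel H A O) (a : A) (h : H) : IsProbabilityMeasure (M.law a h) :=
  M.isProb a h

theorem d_nonneg (M : SensingModel H A O) (a : A) (h g : H) : 0 ≤ M.d a h g :=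
  ENNReal.toReal_nonneg

theorem measurable_logRatio (M : SensingModel H A O) (a : A) (h g : H) :
    Measurable (M.logRatio a h g) :=
  (Real.measurable_log.comp (M.measurable_p a h)).sub
    (Real.measurable_log.comp (M.measurable_p a g))

theorem law_absolutelyContinuous (M : SensingModel H A O) (a : A) (h g : H) :
    M.law a h ≪ M.law a g :=
  (InformationTheory.klDiv_ne_top_iff.1 (M.klDiv_ne_top a h g)).1

/-- Finite divergences make the laws mutually absolutely continuous, so the convention `Real.log 0 =
0` in `logRatio` matters only on null sets. -/
theorem ae_p_pos (M : SensingModel H A O) (a : A) (h g : H) :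
    ∀ᵐ o ∂M.law a h, 0 < M.p a g o := by
  refine (M.law_absolutelyContinuous a h g).ae_le ?_
  have : ∀ᵐ o ∂M.law a g, ENNReal.ofReal (M.p a g o) ≠ 0 := by
    rw [SensingModel.law, ae_withDensity_iff (M.measurable_p a g).ennreal_ofReal]
    exact Eventually.of_forall fun _ h => h
  filter_upwards [this] with o ho
  simpa using ho

theorem lintegral_exp_logRatio_le (M : SensingModel H A O) (a : A) (h i : H) :
    ∫⁻ o, ENNReal.ofReal (Real.exp (M.logRatio a i h o)) ∂M.law a h ≤ 1 := by
  have e : ∫⁻ o, ENNReal.ofReal (Real.exp (M.logRatio a i h o)) ∂M.law a h =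
      ∫⁻ o, ENNReal.ofReal (M.p a i o / M.p a h o) ∂M.law a h := by
    refine lintegral_congr_ae ?_
    filter_upwards [M.ae_p_pos a h i, M.ae_p_pos a h h] with o h1 h2
    rw [logRatio, Real.exp_sub, Real.exp_log h1, Real.exp_log h2]
  have hm : Measurable fun o => ENNReal.ofReal (M.p a i o / M.p a h o) :=
    ((M.measurable_p a i).div (M.measurable_p a h)).ennreal_ofReal
  rw [e, law, lintegral_withDensity_eq_lintegral_mul _ (M.measurable_p a h).ennreal_ofReal hm]
  have h1 : ∫⁻ o, ENNReal.ofReal (M.p a i o) ∂M.base a = 1 := by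
    have := (M.isProb a i).measure_univ
    rwa [withDensity_apply _ MeasurableSet.univ, setLIntegral_univ] at this
  rw [← h1]
  refine lintegral_mono fun o => ?_
  simp only [Pi.mul_apply]
  rw [← ENNReal.ofReal_mul (M.p_nonneg a h o)]
  refine ENNReal.ofReal_le_ofReal ?_
  rcases (M.p_nonneg a h o).eq_or_lt with h0 | h0
  · simp [← h0, M.p_nonneg a i o]
  · rw [mul_div_cancel₀ _ h0.ne']

/-- Zero divergence forces equal laws, hence equal densities almost everywhere. Uninformative
actions thus add no noise, and only positive divergences need a lower bound. -/
theorem logRatio_ae_eq_zero (M : SensingModel H A O) {a : A} {h g : H} (hd : M.d a h g = 0) :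
    ∀ᵐ o ∂M.law a h, M.logRatio a h g o = 0 := by
  have h1 : M.law a h = M.law a g := by
    rw [← InformationTheory.klDiv_eq_zero_iff]
    exact ((ENNReal.toReal_eq_zero_iff _).1 hd).resolve_right (M.klDiv_ne_top a h g)
  have h2 : (fun o => ENNReal.ofReal (M.p a h o)) =ᵐ[M.base a]
      fun o => ENNReal.ofReal (M.p a g o) := by
    refine (withDensity_eq_iff (M.measurable_p a h).ennreal_ofReal.aemeasurable
      (M.measurable_p a g).ennreal_ofReal.aemeasurable ?_).1 h1
    have := (M.isProb a h).measure_univ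
    rw [withDensity_apply _ MeasurableSet.univ, setLIntegral_univ] at this
    simp [this]
  filter_upwards [(withDensity_absolutelyContinuous (M.base a) _).ae_le h2] with o ho
  rw [ENNReal.ofReal_eq_ofReal_iff (M.p_nonneg a h o) (M.p_nonneg a g o)] at ho
  simp [logRatio, ho]

variable {M : SensingModel H A O} {h : H} {v : ℝ≥0}

theorem SubGaussian.lintegral_exp_le (hsub : M.SubGaussian h v) (a : A) {g : H} (hg : g ≠ h)
    (l : ℝ) :
    ∫⁻ o, ENNReal.ofReal (Real.exp (l * (M.logRatio a h g o - M.d a h g) - v * l ^ 2 / 2))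
      ∂M.law a h ≤ 1 := by
  have h1 := (hsub a g hg).mgf_le l
  have h2 := (hsub a g hg).integrable_exp_mul l
  simp_rw [Real.exp_sub]
  rw [← ofReal_integral_eq_lintegral_ofReal (h2.div_const _)
    (Eventually.of_forall fun _ => by positivity), integral_div]
  rw [ENNReal.ofReal_le_one]
  exact div_le_one_of_le₀ h1 (Real.exp_pos _).le

/-- At `λ = -s` the sub-Gaussian exponent contains `s d - v s²/2`, which is at least `s d / 2` when
`s v ≤ d`. As actions with `d = 0` contribute nothing, one `s` serves all actions. -/
theorem SubGaussian.lintegral_exp_neg_le (hsub : M.SubGaussian h v) (a : A) {g : H} (hg : g ≠ h)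
    {s : ℝ} (hs : 0 ≤ s) (hsv : 0 < M.d a h g → s * v ≤ M.d a h g) :
    ∫⁻ o, ENNReal.ofReal (Real.exp (-s * M.logRatio a h g o + s / 2 * M.d a h g))
      ∂M.law a h ≤ 1 := by
  rcases (M.d_nonneg a h g).eq_or_lt with hd | hd
  · have : ∫⁻ o, ENNReal.ofReal (Real.exp (-s * M.logRatio a h g o + s / 2 * M.d a h g))
        ∂M.law a h = ∫⁻ _, 1 ∂M.law a h := by
      refine lintegral_congr_ae ?_
      filter_upwards [M.logRatio_ae_eq_zero hd.symm] with o ho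
      simp [ho, ← hd]
    rw [this]
    simp
  · refine (lintegral_mono fun o => ?_).trans (hsub.lintegral_exp_le a hg (-s))
    refine ENNReal.ofReal_le_ofReal (Real.exp_le_exp.2 ?_)
    have := mul_le_mul_of_nonneg_left (hsv hd) hs
    nlinarith

end SensingModel

end Model

/-! ### Maximal inequality for exponential processes along a run -/

/-- Ville's maximal inequality, for a nonnegative supermartingale given by its set integrals. -/
theorem mul_measure_exists_le {Ω : Type*} {mΩ : MeasurableSpace Ω} {μ : Measure Ω}
    (ℱ : Filtration ℕ mΩ) {X : ℕ → Ω → ℝ≥0∞} (hX : ∀ t, Measurable[ℱ t] (X t))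
    (hstep : ∀ t F, MeasurableSet[ℱ t] F → ∫⁻ ω in F, X (t + 1) ω ∂μ ≤ ∫⁻ ω in F, X t ω ∂μ)
    (a : ℝ≥0∞) : a * μ {ω | ∃ t, a ≤ X t ω} ≤ ∫⁻ ω, X 0 ω ∂μ := by
  -- Induction on the horizon, over arbitrary past events `F`: split `F` by whether the level is
  -- reached at time `t`, and apply `hstep` to the part where it is not.
  have key : ∀ k t F, MeasurableSet[ℱ t] F →
      a * μ (F ∩ {ω | ∃ s, t ≤ s ∧ s ≤ t + k ∧ a ≤ X s ω}) ≤ ∫⁻ ω in F, X t ω ∂μ := by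
    intro k
    induction k with
    | zero =>
      intro t F hF
      have h1 := mul_meas_ge_le_lintegral (μ := μ.restrict F) ((hX t).mono (ℱ.le t) le_rfl) a
      rw [Measure.restrict_apply' (ℱ.le t _ hF), inter_comm] at h1
      refine le_trans (mul_le_mul_right (measure_mono ?_) _) h1
      rintro ω ⟨hω, s, h2, h3, h4⟩
      obtain rfl : s = t := by omega
      exact ⟨hω, h4⟩
    | succ k ih =>
      intro t F hF
      have hE : MeasurableSet[ℱ t] {ω | a ≤ X t ω} := hX t measurableSet_Ici
      have h1 : a * μ (F ∩ {ω | a ≤ X t ω}) ≤ ∫⁻ ω in F ∩ {ω | a ≤ X t ω}, X t ω ∂μ := by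
        rw [← setLIntegral_const]
        exact setLIntegral_mono' (ℱ.le t _ (hF.inter hE)) fun ω hω => hω.2
      have h2 := (ih (t + 1) (F \ {ω | a ≤ X t ω}) (ℱ.mono t.le_succ _ (hF.diff hE))).trans
        (hstep t _ (hF.diff hE))
      rw [← lintegral_inter_add_sdiff (X t) F (ℱ.le t _ hE)]
      refine le_trans ?_ (add_le_add h1 h2)
      rw [← mul_add]
      refine mul_le_mul_right ((measure_mono ?_).trans (measure_union_le _ _)) _
      rintro ω ⟨hω, s, h3, h4, h5⟩
      by_cases h6 : a ≤ X t ω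
      · exact Or.inl ⟨hω, h6⟩
      · refine Or.inr ⟨⟨hω, h6⟩, s, ?_, by omega, h5⟩
        rcases h3.eq_or_lt with rfl | h7
        · exact absurd h5 h6
        · exact h7
  have hU : {ω | ∃ t, a ≤ X t ω} = ⋃ k : ℕ, {ω | ∃ s, 0 ≤ s ∧ s ≤ 0 + k ∧ a ≤ X s ω} := by
    ext ω
    simp only [mem_iUnion]
    exact ⟨fun ⟨t, ht⟩ => ⟨t, t, by omega, by omega, ht⟩, fun ⟨_, t, _, _, ht⟩ => ⟨t, ht⟩⟩
  have hmono : Monotone fun k : ℕ => {ω | ∃ s, 0 ≤ s ∧ s ≤ 0 + k ∧ a ≤ X s ω} :=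
    fun k l hkl ω ⟨s, h1, h2, h3⟩ => ⟨s, h1, by omega, h3⟩
  rw [hU, hmono.measure_iUnion, ENNReal.mul_iSup]
  refine iSup_le fun k => ?_
  simpa using key k 0 univ MeasurableSet.univ

namespace Run

variable {H A O : Type*} [MeasurableSpace O] [Fintype A] [DecidableEq A]
  {M : SensingModel H A O} {h : H} {b c α δ : ℝ} {Ω : Type*} [MeasurableSpace Ω] {μ : Measure Ω}

theorem measurable_comp (R : Run M h b c α δ μ) {β : Type*} [MeasurableSpace β] {ψ : A → O → β}
    (hψ : ∀ a, Measurable (ψ a)) (k : ℕ) :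
    Measurable[R.ℱ (k + 1)] fun ω => ψ (R.act k ω) (R.obs k ω) := by
  -- `A` is finite, so measurability of the level sets of `act` suffices for the discrete σ-algebra.
  let _ : MeasurableSpace A := ⊤
  have h1 : Measurable (Function.uncurry ψ) := measurable_from_prod_countable_right hψ
  have h2 : Measurable[R.ℱ (k + 1)] (R.act k) := by
    refine @measurable_to_countable' _ _ _ _ (R.ℱ (k + 1)) _ fun a => ?_
    exact R.ℱ.mono k.le_succ _ (R.measurable_act k a)
  exact h1.comp (h2.prodMk (R.measurable_obs k))

theorem measurable_sum_comp (R : Run M h b c α δ μ) {ψ : A → O → ℝ}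
    (hψ : ∀ a, Measurable (ψ a)) (t : ℕ) :
    Measurable[R.ℱ t] fun ω => ∑ k ∈ Finset.range t, ψ (R.act k ω) (R.obs k ω) := by
  refine @Finset.measurable_sum _ _ _ _ _ _ (R.ℱ t) _ _ fun k hk => ?_
  exact (R.measurable_comp hψ k).mono (R.ℱ.mono (Finset.mem_range.1 hk)) le_rfl

/-- Given the past, the observation is drawn from the law of the selected action. -/
theorem setLIntegral_mul_obs (R : Run M h b c α δ μ) (t : ℕ) (a : A) {φ : O → ℝ≥0∞}
    (hφ : Measurable φ) {Y : Ω → ℝ≥0∞} (hY : Measurable[R.ℱ t] Y) :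
    ∫⁻ ω in {ω | R.act t ω = a}, Y ω * φ (R.obs t ω) ∂μ =
      (∫⁻ ω in {ω | R.act t ω = a}, Y ω ∂μ) * ∫⁻ o, φ o ∂M.law a h := by
  have hobs : Measurable (R.obs t) := (R.measurable_obs t).mono (R.ℱ.le _) le_rfl
  have hφo : Measurable fun ω => φ (R.obs t ω) := hφ.comp hobs
  refine @Measurable.ennreal_induction _ (R.ℱ t) (fun Y =>
    ∫⁻ ω in {ω | R.act t ω = a}, Y ω * φ (R.obs t ω) ∂μ =
      (∫⁻ ω in {ω | R.act t ω = a}, Y ω ∂μ) * ∫⁻ o, φ o ∂M.law a h) ?_ ?_ ?_ Y hY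
  · intro r F hF
    have hF' := R.ℱ.le t _ hF
    have e : ∀ ω, F.indicator (fun _ => r) ω * φ (R.obs t ω) =
        F.indicator (fun ω => r * φ (R.obs t ω)) ω := fun ω => by
      by_cases hω : ω ∈ F <;> simp [hω]
    simp_rw [e]
    rw [lintegral_indicator hF', lintegral_indicator hF', lintegral_const_mul _ hφo,
      setLIntegral_const, Measure.restrict_restrict hF', Measure.restrict_apply'
        (R.ℱ.le t _ (R.measurable_act t a)), mul_assoc]
    congr 1
    rw [← lintegral_map hφ hobs, ← smul_eq_mul, ← lintegral_smul_measure]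
    congr 1
    ext B hB
    rw [Measure.map_apply hobs hB, Measure.restrict_apply (hobs hB), inter_comm,
      Measure.smul_apply, smul_eq_mul]
    exact R.obs_law t F hF a B hB
  · intro f g _ hf hg h1 h2
    have hf' := hf.mono (R.ℱ.le t) le_rfl
    have hg' := hg.mono (R.ℱ.le t) le_rfl
    simp only [Pi.add_apply, add_mul]
    have hfφ : Measurable fun ω => f ω * φ (R.obs t ω) := hf'.mul hφo
    rw [lintegral_add_left hfφ, lintegral_add_left hf', h1, h2, add_mul]
  · intro f hf hmono h1
    have hf' := fun n => (hf n).mono (R.ℱ.le t) le_rfl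
    simp_rw [ENNReal.iSup_mul]
    have hfφ : ∀ n, Measurable fun ω => f n ω * φ (R.obs t ω) := fun n => (hf' n).mul hφo
    rw [lintegral_iSup hfφ
      fun m n hmn ω => mul_le_mul_left (hmono hmn ω) _, lintegral_iSup hf' hmono, ENNReal.iSup_mul]
    simp_rw [h1]

/-- Chernoff-Ville bound along a run. -/
theorem measure_exists_le_sum_le (R : Run M h b c α δ μ) [IsProbabilityMeasure μ]
    {ψ : A → O → ℝ} (hψ : ∀ a, Measurable (ψ a))
    (hint : ∀ a, ∫⁻ o, ENNReal.ofReal (Real.exp (ψ a o)) ∂M.law a h ≤ 1) (x : ℝ) :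
    μ {ω | ∃ t, x ≤ ∑ k ∈ Finset.range t, ψ (R.act k ω) (R.obs k ω)} ≤
      ENNReal.ofReal (Real.exp (-x)) := by
  set X : ℕ → Ω → ℝ≥0∞ := fun t ω =>
    ENNReal.ofReal (Real.exp (∑ k ∈ Finset.range t, ψ (R.act k ω) (R.obs k ω))) with hXdef
  have hX : ∀ t, Measurable[R.ℱ t] (X t) := fun t =>
    ENNReal.measurable_ofReal.comp (Real.measurable_exp.comp (R.measurable_sum_comp hψ t))
  have hact : ∀ t a, MeasurableSet {ω | R.act t ω = a} := fun t a =>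
    R.ℱ.le t _ (R.measurable_act t a)
  have hsplit : ∀ t (Y : Ω → ℝ≥0∞),
      ∫⁻ ω, Y ω ∂μ = ∑ a, ∫⁻ ω in {ω | R.act t ω = a}, Y ω ∂μ := by
    intro t Y
    rw [← lintegral_biUnion_finset _ fun a _ => hact t a]
    · rw [← setLIntegral_univ]
      congr 2
      ext ω
      simp
    · intro a _ a' _ haa
      rw [Function.onFun, Set.disjoint_left]
      intro ω h1 h2
      exact haa (h1.symm.trans h2)
  have hstep : ∀ t F, MeasurableSet[R.ℱ t] F →
      ∫⁻ ω in F, X (t + 1) ω ∂μ ≤ ∫⁻ ω in F, X t ω ∂μ := by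
    intro t F hF
    have hF' := R.ℱ.le t _ hF
    rw [← lintegral_indicator hF', ← lintegral_indicator hF', hsplit t, hsplit t]
    refine Finset.sum_le_sum fun a _ => ?_
    have e : ∫⁻ ω in {ω | R.act t ω = a}, F.indicator (X (t + 1)) ω ∂μ =
        ∫⁻ ω in {ω | R.act t ω = a},
          F.indicator (X t) ω * ENNReal.ofReal (Real.exp (ψ a (R.obs t ω))) ∂μ := by
      refine setLIntegral_congr_fun (hact t a) fun ω hω => ?_
      have hω' : R.act t ω = a := hω
      by_cases hωF : ω ∈ F
      · simp only [indicator_of_mem hωF, hXdef, Finset.sum_range_succ, Real.exp_add, hω']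
        rw [ENNReal.ofReal_mul (Real.exp_pos _).le]
      · simp [indicator_of_notMem hωF]
    have hm : Measurable fun o => ENNReal.ofReal (Real.exp (ψ a o)) :=
      (Real.measurable_exp.comp (hψ a)).ennreal_ofReal
    rw [e, R.setLIntegral_mul_obs t a hm ((hX t).indicator hF)]
    exact mul_le_of_le_one_right' (hint a)
  have hV := mul_measure_exists_le (μ := μ) R.ℱ hX hstep (ENNReal.ofReal (Real.exp x))
  have h0 : ∫⁻ ω, X 0 ω ∂μ = 1 := by simp [hXdef]
  rw [h0] at hV
  have hpos : ENNReal.ofReal (Real.exp x) ≠ 0 := by simp [Real.exp_pos]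
  rw [Real.exp_neg, ENNReal.ofReal_inv_of_pos (Real.exp_pos x)]
  rw [mul_comm] at hV
  refine le_trans (measure_mono ?_) ((ENNReal.le_inv_iff_mul_le).2 hV)
  rintro ω ⟨t, ht⟩
  exact ⟨t, ENNReal.ofReal_le_ofReal (Real.exp_le_exp.2 ht)⟩

end Run

end ElimTaS

namespace ElimTaS

/-! ### Tail bounds -/

/-- The bound `exp x ≥ x⁴/4!` at `x = c √r` gives comparison with `∑ 1/r²`. -/
theorem summable_exp_neg_mul_sqrt {c : ℝ} (hc : 0 < c) :
    Summable fun r : ℕ => Real.exp (-(c * Real.sqrt r)) := by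
  have h1 : Summable fun r : ℕ => 24 / c ^ 4 * (1 / (r : ℝ) ^ 2) :=
    (Real.summable_one_div_nat_pow.2 (by norm_num)).mul_left _
  refine h1.of_norm_bounded_eventually_nat ?_
  filter_upwards [eventually_ge_atTop 1] with r hr
  have hr' : (0 : ℝ) < r := by exact_mod_cast hr
  rw [Real.norm_of_nonneg (Real.exp_pos _).le, Real.exp_neg]
  have h2 := Real.pow_div_factorial_le_exp (c * Real.sqrt r) (by positivity) 4
  have h3 : (c * Real.sqrt r) ^ 4 = c ^ 4 * (r : ℝ) ^ 2 := by
    rw [mul_pow, show Real.sqrt r ^ 4 = (Real.sqrt r ^ 2) ^ 2 by ring, Real.sq_sqrt hr'.le]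
  rw [h3] at h2
  calc (Real.exp (c * Real.sqrt r))⁻¹ ≤ (c ^ 4 * (r : ℝ) ^ 2 / (Nat.factorial 4 : ℕ))⁻¹ :=
        inv_anti₀ (by positivity) h2
    _ = 24 / c ^ 4 * (1 / (r : ℝ) ^ 2) := by
        simp [Nat.factorial]
        field_simp

/-- Applied to the divergences from `h`, this supplies the `m` that fixes the decay rate `r =
m²/(2v)` and then `κ₀`. -/
theorem exists_pos_forall_le_of_pos {ι : Type*} [Finite ι] (f : ι → ℝ) :
    ∃ m : ℝ, 0 < m ∧ ∀ i, 0 < f i → m ≤ f i := by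
  have h1 : ∀ᶠ m in nhdsWithin (0 : ℝ) (Ioi 0), ∀ i, 0 < f i → m ≤ f i := by
    refine eventually_all.2 fun i => ?_
    by_cases hi : 0 < f i
    · filter_upwards [nhdsWithin_le_nhds (Iic_mem_nhds hi)] with m hm _ using hm
    · exact Eventually.of_forall fun _ h => absurd h hi
  obtain ⟨m, h2, h3⟩ := (h1.and self_mem_nhdsWithin).exists
  exact ⟨m, h3, h2⟩

section Path

variable {H A O : Type*} [MeasurableSpace O]

theorem Z_eq_sum_logRatio (M : SensingModel H A O) (x : ℕ → A) (y : ℕ → O) (t : ℕ) (i g : H) :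
    Z M x y t i g = ∑ k ∈ Finset.range t, M.logRatio (x k) i g (y k) := by
  simp [Z, logLik, SensingModel.logRatio, Finset.sum_sub_distrib]

theorem Z_eq_sum_count_add_mart [Fintype A] [DecidableEq A] (M : SensingModel H A O)
    (x : ℕ → A) (y : ℕ → O) (t : ℕ) (i g : H) :
    Z M x y t i g = ∑ a, (count x t a : ℝ) * M.d a i g + mart M i x y t g := by
  rw [Z_eq_sum_logRatio, mart, Finset.sum_sub_distrib,
    sum_range_comp_eq_sum_count x (fun a => M.d a i g)]
  ring

end Path

namespace Run

variable {H A O : Type*} [MeasurableSpace O] [Fintype A] [DecidableEq A]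
  {M : SensingModel H A O} {h : H} {b c α δ : ℝ} {Ω : Type*} [MeasurableSpace Ω] {μ : Measure Ω}
  {v : ℝ≥0}

theorem measure_exists_le_Z_le [IsProbabilityMeasure μ] (R : Run M h b c α δ μ) (i : H) (x : ℝ) :
    μ {ω | ∃ t, x ≤ Z M (fun k => R.act k ω) (fun k => R.obs k ω) t i h} ≤
      ENNReal.ofReal (Real.exp (-x)) := by
  simp_rw [Z_eq_sum_logRatio]
  exact R.measure_exists_le_sum_le (fun a => M.measurable_logRatio a i h)
    (fun a => M.lintegral_exp_logRatio_le a h i) x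

theorem measure_le_mul_mart_le [IsProbabilityMeasure μ] (R : Run M h b c α δ μ)
    (hsub : M.SubGaussian h v) {g : H} (hg : g ≠ h) (l x : ℝ) (s : ℕ) :
    μ {ω | x ≤ l * mart M h (fun k => R.act k ω) (fun k => R.obs k ω) s g} ≤
      ENNReal.ofReal (Real.exp (-(x - s * (v * l ^ 2 / 2)))) := by
  refine le_trans (measure_mono ?_) (R.measure_exists_le_sum_le
    (ψ := fun a o => l * (M.logRatio a h g o - M.d a h g) - v * l ^ 2 / 2)
    (fun a => (((M.measurable_logRatio a h g).sub_const _).const_mul l).sub_const _)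
    (fun a => hsub.lintegral_exp_le a hg l) _)
  intro ω hω
  refine ⟨s, ?_⟩
  rw [Finset.sum_sub_distrib, ← Finset.mul_sum]
  simp only [Finset.sum_const, Finset.card_range, nsmul_eq_mul]
  exact sub_le_sub_right hω _

theorem measure_lt_abs_mart_le [IsProbabilityMeasure μ] (R : Run M h b c α δ μ)
    (hsub : M.SubGaussian h v) (hv : 0 < v) {g : H} (hg : g ≠ h) {x : ℝ} (hx : 0 ≤ x) {s : ℕ}
    (hs : 1 ≤ s) :
    μ {ω | x < |mart M h (fun k => R.act k ω) (fun k => R.obs k ω) s g|} ≤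
      ENNReal.ofReal (2 * Real.exp (-(x ^ 2 / (2 * s * v)))) := by
  have hs' : (0 : ℝ) < s := by exact_mod_cast hs
  have hv' : (0 : ℝ) < v := by exact_mod_cast hv
  -- The optimal Chernoff exponent; `l` and `-l` treat the two signs.
  set l : ℝ := x / (s * v) with hl
  have hl0 : 0 ≤ l := by positivity
  have e : ∀ l', l' ^ 2 = l ^ 2 → -(l * x - s * (v * l' ^ 2 / 2)) = -(x ^ 2 / (2 * s * v)) := by
    intro l' h'
    rw [h', hl]
    field_simp
    ring
  have h1 := R.measure_le_mul_mart_le hsub hg l (l * x) s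
  have h2 := R.measure_le_mul_mart_le hsub hg (-l) (l * x) s
  rw [e _ rfl] at h1
  rw [e _ (by ring)] at h2
  rw [two_mul, ENNReal.ofReal_add (Real.exp_pos _).le (Real.exp_pos _).le]
  refine le_trans (measure_mono ?_) ((measure_union_le _ _).trans (add_le_add h1 h2))
  intro ω hω
  have hω' : x < |mart M h (fun k => R.act k ω) (fun k => R.obs k ω) s g| := hω
  rcases lt_abs.1 hω' with h3 | h3
  · exact Or.inl (mul_le_mul_of_nonneg_left h3.le hl0)
  · refine Or.inr ?_
    have := mul_le_mul_of_nonneg_left h3.le hl0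
    rw [mem_ofPred_eq]
    linarith

/-- Forced exploration makes a wrong champion exponentially unlikely in `√t`. -/
theorem measure_champ_ne_le [IsProbabilityMeasure μ] [Fintype H] (R : Run M h b c α δ μ)
    (hM : M.Identifiable) (hsub : M.SubGaussian h v) (hv : 0 < v) {m : ℝ} (hm : 0 < m)
    (hmd : ∀ a g, 0 < M.d a h g → m ≤ M.d a h g) (t : ℕ) :
    μ {ω | R.champ t ω ≠ h} ≤ ENNReal.ofReal (Fintype.card H *
      Real.exp (-(m ^ 2 / (2 * v) * (Real.sqrt t - 2 * Fintype.card A)))) := by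
  classical
  have hv' : (0 : ℝ) < v := by exact_mod_cast hv
  set r : ℝ := m ^ 2 / (2 * v) with hr
  -- The largest exponent with `s v ≤ d` for all positive divergences; it gives the rate `s m / 2 =
  -- r`.
  set s : ℝ := m / v with hsdef
  have hs : 0 < s := by positivity
  have key : ∀ g, g ≠ h →
      μ {ω | Z M (fun k => R.act k ω) (fun k => R.obs k ω) t h g ≤ 0} ≤
        ENNReal.ofReal (Real.exp (-(r * (Real.sqrt t - 2 * Fintype.card A)))) := by
    intro g hg
    obtain ⟨a₀, ha₀⟩ := hM h g hg.symm
    refine le_trans (measure_mono ?_) (R.measure_exists_le_sum_le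
      (ψ := fun a o => -s * M.logRatio a h g o + s / 2 * M.d a h g)
      (fun a => ((M.measurable_logRatio a h g).const_mul _).add_const _)
      (fun a => hsub.lintegral_exp_neg_le a hg hs.le fun hd => ?_) _)
    · intro ω hω
      refine ⟨t, ?_⟩
      rw [Finset.sum_add_distrib, ← Finset.mul_sum, ← Finset.mul_sum, ← Z_eq_sum_logRatio M
        (fun k => R.act k ω) (fun k => R.obs k ω) t h g,
        sum_range_comp_eq_sum_count (fun k => R.act k ω) (fun a => M.d a h g)]
      have h1 : (count (fun k => R.act k ω) t a₀ : ℝ) * M.d a₀ h g ≤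
          ∑ a, (count (fun k => R.act k ω) t a : ℝ) * M.d a h g :=
        Finset.single_le_sum (fun a _ => mul_nonneg (Nat.cast_nonneg _) (M.d_nonneg a h g))
          (Finset.mem_univ a₀)
      have h2 : (count (fun k => R.act k ω) t a₀ : ℝ) * m ≤
          (count (fun k => R.act k ω) t a₀ : ℝ) * M.d a₀ h g :=
        mul_le_mul_of_nonneg_left (hmd a₀ g ha₀) (Nat.cast_nonneg _)
      have h3 : (Real.sqrt t - 2 * Fintype.card A) * m ≤
          (count (fun k => R.act k ω) t a₀ : ℝ) * m :=
        mul_le_mul_of_nonneg_right (R.sqrt_sub_le_count ω t a₀) hm.le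
      have h4 := mul_le_mul_of_nonneg_left (h3.trans (h2.trans h1)) (half_pos hs).le
      have h5 : 0 ≤ -s * Z M (fun k => R.act k ω) (fun k => R.obs k ω) t h g :=
        mul_nonneg_of_nonpos_of_nonpos (by linarith) hω
      have h6 : r * (Real.sqrt t - 2 * Fintype.card A) =
          s / 2 * ((Real.sqrt t - 2 * Fintype.card A) * m) := by
        rw [hr, hsdef]
        field_simp
      linarith
    · rw [hsdef, div_mul_cancel₀ _ hv'.ne']
      exact hmd a g hd
  have hsubset : {ω | R.champ t ω ≠ h} ⊆ ⋃ g ∈ Finset.univ.filter (fun g : H => g ≠ h),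
      {ω | Z M (fun k => R.act k ω) (fun k => R.obs k ω) t h g ≤ 0} := by
    intro ω hω
    simp only [Finset.mem_filter, Finset.mem_univ, true_and, mem_iUnion]
    exact ⟨R.champ t ω, hω, sub_nonpos.2 (R.champ_max t ω h)⟩
  refine (measure_mono hsubset).trans ((measure_biUnion_finset_le _ _).trans ?_)
  refine (Finset.sum_le_card_nsmul _ _ _ fun g hg => key g (by simpa using hg)).trans ?_
  rw [nsmul_eq_mul, ENNReal.ofReal_mul (Nat.cast_nonneg _), ENNReal.ofReal_natCast]
  refine mul_le_mul_left ?_ _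
  exact_mod_cast Finset.card_le_univ _

/-- A union bound over all rounds `n + k`. The inequality `√(n+k) ≥ (√n + √k)/2` splits off a factor
summable in `k`. -/
theorem measure_not_Tch_le [IsProbabilityMeasure μ] (R : Run M h b c α δ μ) {B r : ℝ}
    (hB : 0 ≤ B) (hr : 0 < r)
    (hchamp : ∀ t, μ {ω | R.champ t ω ≠ h} ≤ ENNReal.ofReal (B * Real.exp (-(r * Real.sqrt t))))
    {n : ℕ} (hn : 1 ≤ n) :
    μ {ω | ¬ R.Tch ω ≤ n} ≤ ENNReal.ofReal (B * (∑' k : ℕ, Real.exp (-(r / 2 * Real.sqrt k))) *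
      Real.exp (-(r / 2 * Real.sqrt n))) := by
  have hsubset : {ω | ¬ R.Tch ω ≤ n} ⊆ ⋃ k : ℕ, {ω | R.champ (n + k) ω ≠ h} := by
    intro ω hω
    by_contra hcon
    simp only [mem_iUnion, not_exists, mem_ofPred_eq, not_not] at hcon
    refine hω (sInf_le ⟨n, ⟨hn, fun r hr => ?_⟩, rfl⟩)
    obtain ⟨k, rfl⟩ := Nat.exists_eq_add_of_le hr
    exact hcon k
  have hsum := summable_exp_neg_mul_sqrt (half_pos hr)
  refine (measure_mono hsubset).trans ((measure_iUnion_le _).trans ?_)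
  rw [mul_right_comm, ← tsum_mul_left, ENNReal.ofReal_tsum_of_nonneg
    (fun k => by positivity) (hsum.mul_left _)]
  refine ENNReal.tsum_le_tsum fun k => (hchamp _).trans (ENNReal.ofReal_le_ofReal ?_)
  rw [mul_assoc, ← Real.exp_add]
  refine mul_le_mul_of_nonneg_left (Real.exp_le_exp.2 ?_) hB
  have h1 : Real.sqrt n ≤ Real.sqrt ((n + k : ℕ) : ℝ) := Real.sqrt_le_sqrt (by push_cast; simp)
  have h2 : Real.sqrt k ≤ Real.sqrt ((n + k : ℕ) : ℝ) := Real.sqrt_le_sqrt (by push_cast; simp)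
  nlinarith

/-- The condition `κ ≥ 16/r²` makes `(r/2)√(κ log² t) ≥ 2 log t`, whence `t^{-2}`. The condition `η²
≥ 10v` gives `t^{-5}` for each `s`, and the union over `s ≤ t` leaves `t^{-4}`. -/
theorem measure_goodEvent_compl_le [IsProbabilityMeasure μ] [Fintype H] (R : Run M h b c α δ μ)
    (hsub : M.SubGaussian h v) (hv : 0 < v) {B r κ η : ℝ} (hB : 0 ≤ B) (hr : 0 < r)
    (hchamp : ∀ t, μ {ω | R.champ t ω ≠ h} ≤ ENNReal.ofReal (B * Real.exp (-(r * Real.sqrt t))))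
    (hκ : 16 / r ^ 2 ≤ κ) (hη : Real.sqrt (10 * v) ≤ η) {t : ℕ} (ht : 3 ≤ t) :
    μ (R.goodEvent κ η t)ᶜ ≤ ENNReal.ofReal
      ((B * (∑' k : ℕ, Real.exp (-(r / 2 * Real.sqrt k))) + 2 * Fintype.card H) *
        (1 / (t : ℝ) ^ 2)) := by
  classical
  have hv' : (0 : ℝ) < v := by exact_mod_cast hv
  have ht3 : (3 : ℝ) ≤ t := by exact_mod_cast ht
  have ht0 : (0 : ℝ) < t := by linarith
  have hlog : 0 < Real.log t := Real.log_pos (by linarith)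
  have hκ0 : 0 < κ := lt_of_lt_of_le (by positivity) hκ
  set L : ℝ := Real.log (Real.exp 1 + t) with hL
  have hLt : Real.log t ≤ L := Real.log_le_log ht0 (by have := Real.exp_pos 1; linarith)
  have hL0 : 0 < L := hlog.trans_le hLt
  have hexp : ∀ k : ℕ, Real.exp (-(k * Real.log t)) = 1 / (t : ℝ) ^ k := by
    intro k
    rw [Real.exp_neg, Real.exp_nat_mul, Real.exp_log ht0, one_div]
  -- stabilization of the champion
  have h1 : μ {ω | ¬ R.Tch ω ≤ (⌈κ * Real.log t ^ 2⌉₊ : ℕ∞)} ≤ ENNReal.ofReal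
      (B * (∑' k : ℕ, Real.exp (-(r / 2 * Real.sqrt k))) * (1 / (t : ℝ) ^ 2)) := by
    refine (R.measure_not_Tch_le hB hr hchamp
      (Nat.one_le_ceil_iff.2 (by positivity))).trans (ENNReal.ofReal_le_ofReal ?_)
    refine mul_le_mul_of_nonneg_left ?_ (mul_nonneg hB (tsum_nonneg fun _ => (Real.exp_pos _).le))
    rw [← hexp 2]
    refine Real.exp_le_exp.2 (neg_le_neg ?_)
    have h2 : 4 / r * Real.log t ≤ Real.sqrt (⌈κ * Real.log t ^ 2⌉₊ : ℝ) := by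
      refine Real.le_sqrt_of_sq_le (le_trans ?_ (Nat.le_ceil _))
      calc (4 / r * Real.log t) ^ 2 = 16 / r ^ 2 * Real.log t ^ 2 := by
            rw [mul_pow, div_pow]; norm_num
        _ ≤ κ * Real.log t ^ 2 := by gcongr
    calc ((2 : ℕ) : ℝ) * Real.log t = r / 2 * (4 / r * Real.log t) := by
          push_cast; field_simp; norm_num
      _ ≤ _ := by gcongr
  -- fluctuations
  have h2 : ∀ g, g ≠ h → ∀ s ∈ Finset.Icc 1 t,
      μ {ω | η * Real.sqrt (s * L) < |mart M h (fun k => R.act k ω) (fun k => R.obs k ω) s g|} ≤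
        ENNReal.ofReal (2 * (1 / (t : ℝ) ^ 5)) := by
    intro g hg s hs
    have hs1 := (Finset.mem_Icc.1 hs).1
    have hs' : (0 : ℝ) < s := by exact_mod_cast hs1
    refine (R.measure_lt_abs_mart_le hsub hv hg
      (mul_nonneg ((Real.sqrt_nonneg _).trans hη) (Real.sqrt_nonneg _)) hs1).trans (ENNReal.ofReal_le_ofReal ?_)
    rw [← hexp 5]
    refine mul_le_mul_of_nonneg_left (Real.exp_le_exp.2 (neg_le_neg ?_)) (by norm_num)
    rw [mul_pow, Real.sq_sqrt (by positivity), le_div_iff₀ (by positivity)]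
    have h3 : 10 * (v : ℝ) ≤ η ^ 2 := (Real.sqrt_le_left ((Real.sqrt_nonneg _).trans hη)).1 hη
    calc ((5 : ℕ) : ℝ) * Real.log t * (2 * s * v) = 10 * v * (s * Real.log t) := by
          push_cast; ring
      _ ≤ η ^ 2 * (s * L) := by gcongr
  have hsubset : (R.goodEvent κ η t)ᶜ ⊆ {ω | ¬ R.Tch ω ≤ (⌈κ * Real.log t ^ 2⌉₊ : ℕ∞)} ∪
      ⋃ g ∈ Finset.univ.filter (fun g : H => g ≠ h), ⋃ s ∈ Finset.Icc 1 t,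
        {ω | η * Real.sqrt (s * L) <
          |mart M h (fun k => R.act k ω) (fun k => R.obs k ω) s g|} := by
    intro ω hω
    rw [goodEvent, compl_inter] at hω
    rcases hω with hω | hω
    · exact Or.inl hω
    · right
      simp only [mem_compl_iff, mem_ofPred_eq, not_forall, not_le] at hω
      obtain ⟨g, hg, s, hs, hlt⟩ := hω
      simp only [Finset.mem_filter, Finset.mem_univ, true_and, mem_iUnion, Finset.mem_Icc]
      refine ⟨g, hg, s, ⟨Nat.one_le_iff_ne_zero.2 ?_, hs⟩, hlt⟩
      rintro rfl
      simp [mart] at hlt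
  refine (measure_mono hsubset).trans ((measure_union_le _ _).trans ?_)
  have h3 : μ (⋃ g ∈ Finset.univ.filter (fun g : H => g ≠ h), ⋃ s ∈ Finset.Icc 1 t,
        {ω | η * Real.sqrt (s * L) <
          |mart M h (fun k => R.act k ω) (fun k => R.obs k ω) s g|}) ≤
      ENNReal.ofReal (2 * Fintype.card H * (1 / (t : ℝ) ^ 2)) := by
    have h4 : ∀ g ∈ Finset.univ.filter (fun g : H => g ≠ h),
        μ (⋃ s ∈ Finset.Icc 1 t, {ω | η * Real.sqrt (s * L) <
          |mart M h (fun k => R.act k ω) (fun k => R.obs k ω) s g|}) ≤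
        ENNReal.ofReal (2 * (1 / (t : ℝ) ^ 2)) := by
      intro g hg
      refine (measure_biUnion_finset_le _ _).trans ((Finset.sum_le_card_nsmul _ _ _
        (h2 g (by simpa using hg))).trans ?_)
      rw [Nat.card_Icc, nsmul_eq_mul, ← ENNReal.ofReal_natCast,
        ← ENNReal.ofReal_mul (Nat.cast_nonneg _)]
      refine ENNReal.ofReal_le_ofReal ?_
      have h5 : (1 : ℝ) / t ^ 4 ≤ 1 / t ^ 2 :=
        one_div_le_one_div_of_le (by positivity) (pow_le_pow_right₀ (by linarith) (by norm_num))
      calc ((t + 1 - 1 : ℕ) : ℝ) * (2 * (1 / (t : ℝ) ^ 5)) = 2 * (1 / t ^ 4) := by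
            rw [Nat.add_sub_cancel]
            field_simp
        _ ≤ _ := by gcongr
    refine (measure_biUnion_finset_le _ _).trans ((Finset.sum_le_card_nsmul _ _ _ h4).trans ?_)
    rw [nsmul_eq_mul, ← ENNReal.ofReal_natCast, ← ENNReal.ofReal_mul (Nat.cast_nonneg _)]
    refine ENNReal.ofReal_le_ofReal ?_
    have h6 : ((Finset.univ.filter (fun g : H => g ≠ h)).card : ℝ) ≤ Fintype.card H := by
      exact_mod_cast Finset.card_le_univ _
    calc _ ≤ (Fintype.card H : ℝ) * (2 * (1 / (t : ℝ) ^ 2)) := by gcongr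
      _ = _ := by ring
  rw [add_mul, ENNReal.ofReal_add (mul_nonneg (mul_nonneg hB
    (tsum_nonneg fun _ => (Real.exp_pos _).le)) (by positivity)) (by positivity)]
  exact add_le_add h1 h3

end Run

end ElimTaS

namespace ElimTaS

/-! ### Oracle rates -/

namespace SensingModel

theorem Identifiable.nonempty {H A O : Type*} [MeasurableSpace O]
    {M : SensingModel H A O} [Nontrivial H] (hM : M.Identifiable) : Nonempty A := by
  obtain ⟨h, g, hg⟩ := exists_pair_ne H
  exact ⟨(hM h g hg).choose⟩

variable {H A O : Type*} [MeasurableSpace O] [Fintype A] [Finite H] (M : SensingModel H A O)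

theorem f_le {h g : H} {S : Set H} (hg : g ∈ S) (w : A → ℝ) :
    M.f h S w ≤ ∑ a, w a * M.d a h g :=
  ciInf_le (f := fun g : S => ∑ a, w a * M.d a h g) (Set.finite_range _).bddBelow ⟨g, hg⟩

/-- The member `g` excludes `S = ∅`, where the real infimum is `0` and monotonicity can fail. -/
theorem f_anti {h g : H} {S S' : Set H} (hg : g ∈ S) (hS : S ⊆ S') (w : A → ℝ) :
    M.f h S' w ≤ M.f h S w := by
  have : Nonempty S := ⟨⟨g, hg⟩⟩
  exact le_ciInf fun g' => M.f_le (hS g'.2) w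

variable {M}

/-- Removing opponents only raises the optimal worst-case rate, so elimination never slows the gain
against a survivor below the initial oracle rate. -/
theorem IsOracle.Dstar_le {h g : H} {S S' : Set H} {w : A → ℝ} (hw : M.IsOracle h S w)
    (hg : g ∈ S) (hS : S ⊆ S') : M.Dstar h S' ≤ ∑ a, w a * M.d a h g := by
  have : Nonempty (stdSimplex ℝ A) := ⟨⟨w, hw.1⟩⟩
  exact ciSup_le fun w' => ((M.f_anti hg hS w').trans (hw.2 w' w'.2)).trans (M.f_le hg w)

/-- The uniform allocation gains information against each opponent, and the minimum over finitely
many opponents is attained. -/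
theorem Identifiable.Dstar_pos [Nontrivial H] (hM : M.Identifiable) (h : H) :
    0 < M.Dstar h {h}ᶜ := by
  have := hM.nonempty
  obtain ⟨g₀, hg₀⟩ := exists_ne h
  have hK : (0 : ℝ) < Fintype.card A := by exact_mod_cast Fintype.card_pos
  have hw₀ : (fun _ : A => 1 / (Fintype.card A : ℝ)) ∈ stdSimplex ℝ A := by
    refine ⟨fun _ => by positivity, ?_⟩
    simp [hK.ne']
  have hbdd : BddAbove (range fun w : stdSimplex ℝ A => M.f h {h}ᶜ w) := by
    refine ⟨∑ a, M.d a h g₀, ?_⟩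
    rintro _ ⟨w, rfl⟩
    refine (M.f_le (by simpa using hg₀) w).trans (Finset.sum_le_sum fun a _ => ?_)
    refine mul_le_of_le_one_left (M.d_nonneg a h g₀) ?_
    rw [← w.2.2]
    exact Finset.single_le_sum (fun c _ => w.2.1 c) (Finset.mem_univ a)
  refine lt_of_lt_of_le ?_ (le_ciSup hbdd ⟨_, hw₀⟩)
  have : Nonempty ({h}ᶜ : Set H) := ⟨⟨g₀, by simpa using hg₀⟩⟩
  obtain ⟨g, hg⟩ := exists_eq_ciInf_of_finite
    (f := fun g : ({h}ᶜ : Set H) => ∑ a, 1 / (Fintype.card A : ℝ) * M.d a h g)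
  refine lt_of_lt_of_eq ?_ hg
  obtain ⟨a, ha⟩ := hM h g fun e => g.2 e.symm
  exact Finset.sum_pos' (fun a _ => mul_nonneg (by positivity) (M.d_nonneg a h g))
    ⟨a, Finset.mem_univ a, by positivity⟩

theorem d_le_lip {h g : H} {S : Set H} (hg : g ∈ S) (a : A) : M.d a h g ≤ M.lip h S :=
  (le_ciSup (f := fun a => M.d a h g) (Set.finite_range _).bddAbove a).trans
    (le_ciSup (f := fun g : S => ⨆ a, M.d a h g) (Set.finite_range _).bddAbove ⟨g, hg⟩)

end SensingModel

/-! ### Active-opponent sets and elimination chains -/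

section Path

variable {H A O : Type*} [MeasurableSpace O]

theorem activeSet_antitone (M : SensingModel H A O) (b c α δ : ℝ) (x : ℕ → A) (y : ℕ → O)
    (champ : ℕ → H) (i : H) : Antitone fun t => activeSet M b c α δ x y champ t i :=
  fun _ _ hst _ hg => ⟨hg.1, fun r h1 h2 => hg.2 r h1 (h2.trans hst)⟩

theorem activeSet_subset_compl (M : SensingModel H A O) (b c α δ : ℝ) (x : ℕ → A) (y : ℕ → O)
    (champ : ℕ → H) (t : ℕ) (i : H) : activeSet M b c α δ x y champ t i ⊆ {i}ᶜ :=
  fun _ hg => hg.1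

/-- The last opponent of `i` is eliminated in a round at which `i` is the champion. -/
theorem exists_champ_of_activeSet_eq_empty [Nontrivial H] (M : SensingModel H A O)
    (b c α δ : ℝ) (x : ℕ → A) (y : ℕ → O) (champ : ℕ → H) (i : H) {t : ℕ}
    (ht : activeSet M b c α δ x y champ t i = ∅) :
    ∃ s, 1 ≤ s ∧ s ≤ t ∧ champ s = i ∧ activeSet M b c α δ x y champ s i = ∅ := by
  induction t with
  | zero =>
    obtain ⟨g, hg⟩ := exists_ne i
    rw [activeSet_zero] at ht
    exact absurd (show g ∈ ({i}ᶜ : Set H) from hg) (by rw [ht]; exact notMem_empty g)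
  | succ t ih =>
    by_cases hc : champ (t + 1) = i
    · exact ⟨t + 1, by omega, le_rfl, hc, ht⟩
    · rw [activeSet_succ_other M b c α δ x y champ t i hc] at ht
      obtain ⟨s, h1, h2, h3⟩ := ih ht
      exact ⟨s, h1, by omega, h3⟩

/-- The transition times of a decreasing sequence up to a time of transition. -/
theorem exists_transition_times {β : Type*} [PartialOrder β] {V : ℕ → β} (hV : Antitone V)
    (n : ℕ) (hn : n = 0 ∨ V n ≠ V (n - 1)) :
    ∃ (len : ℕ) (T : ℕ → ℕ), T 0 = 0 ∧ T len = n ∧ ∀ k < len,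
      T k < T (k + 1) ∧ V (T (k + 1)) < V (T k) ∧ ∀ t, T k ≤ t → t < T (k + 1) →
        V t = V (T k) := by
  classical
  induction n using Nat.strong_induction_on with
  | _ n ih =>
    rcases Nat.eq_zero_or_pos n with rfl | hpos
    · exact ⟨0, fun _ => 0, rfl, rfl, fun k hk => absurd hk (by omega)⟩
    have hne : V n ≠ V (n - 1) := hn.resolve_left hpos.ne'
    have hex : ∃ m, V m = V (n - 1) := ⟨n - 1, rfl⟩
    -- The first time at which the value just before `n` is taken, that is, the previous transition.
    set m := Nat.find hex with hm
    have hVm : V m = V (n - 1) := Nat.find_spec hex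
    have hmn : m ≤ n - 1 := Nat.find_min' hex rfl
    have hm' : m = 0 ∨ V m ≠ V (m - 1) := by
      rcases Nat.eq_zero_or_pos m with h0 | h0
      · exact Or.inl h0
      · exact Or.inr fun e => Nat.find_min hex (m := m - 1) (by omega) (e.symm.trans hVm)
    obtain ⟨len, T, hT0, hTl, hT⟩ := ih m (by omega) hm'
    refine ⟨len + 1, fun k => if k ≤ len then T k else n, by simp [hT0], by simp, ?_⟩
    intro k hk
    rcases Nat.lt_or_ge k len with hkl | hkl
    · simpa [hkl.le, Nat.succ_le_of_lt hkl] using hT k hkl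
    · obtain rfl : k = len := by omega
      simp only [le_refl, if_true, Nat.not_succ_le_self, if_false, hTl]
      refine ⟨by omega, ?_, fun t h1 h2 => le_antisymm (hV h1) ?_⟩
      · rw [hVm]
        exact lt_of_le_of_ne (hV (by omega)) hne
      · rw [hVm]
        exact hV (by omega)

end Path

/-! ### Stopping, chain events and the good event -/

namespace Run

variable {H A O : Type*} [MeasurableSpace O] [Fintype A] [DecidableEq A]
  {M : SensingModel H A O} {h : H} {b c α δ : ℝ} {Ω : Type*} [MeasurableSpace Ω] {μ : Measure Ω}

theorem tau_le (R : Run M h b c α δ μ) {ω : Ω} {t : ℕ} (ht : 1 ≤ t)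
    (hG : R.G t (R.champ t ω) ω = ∅) : R.tau ω ≤ t :=
  sInf_le ⟨t, ⟨ht, hG⟩, rfl⟩

theorem exists_of_tau_ne_top (R : Run M h b c α δ μ) {ω : Ω} (hτ : R.tau ω ≠ ⊤) :
    ∃ n : ℕ, R.tau ω = n ∧ 1 ≤ n ∧ R.G n (R.champ n ω) ω = ∅ := by
  have hne : ((fun n : ℕ => (n : ℕ∞)) ''
      {t : ℕ | 1 ≤ t ∧ R.G t (R.champ t ω) ω = ∅}).Nonempty := by
    by_contra hcon
    rw [not_nonempty_iff_eq_empty] at hcon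
    exact hτ (by rw [tau, hcon, sInf_empty])
  obtain ⟨n, hn, e⟩ := csInf_mem hne
  exact ⟨n, e.symm, hn⟩

theorem champ_eq_of_Tch_le (R : Run M h b c α δ μ) {ω : Ω} {m : ℕ} (hm : R.Tch ω ≤ m) {r : ℕ}
    (hr : m ≤ r) : R.champ r ω = h := by
  have hne : ((fun n : ℕ => (n : ℕ∞)) ''
      {s : ℕ | 1 ≤ s ∧ ∀ r ≥ s, R.champ r ω = h}).Nonempty := by
    by_contra hcon
    rw [not_nonempty_iff_eq_empty] at hcon
    rw [Tch, hcon, sInf_empty] at hm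
    exact absurd hm (by simp)
  obtain ⟨n, hn, e⟩ := csInf_mem hne
  have : (n : ℕ∞) ≤ m := e.trans_le hm
  exact hn.2 r (le_trans (by exact_mod_cast this) hr)

/-- Every run that stops with the true hypothesis follows an elimination chain. -/
theorem mem_corrEvent [Nontrivial H] (R : Run M h b c α δ μ) {ω : Ω} {n : ℕ}
    (hτ : R.tau ω = n) (hG : R.G n (R.champ n ω) ω = ∅) (hc : R.champ n ω = h) :
    ω ∈ R.corrEvent := by
  rw [hc] at hG
  have hanti : Antitone fun t => R.G t h ω := activeSet_antitone M b c α δ _ _ _ h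
  -- Stopping is itself a transition: were `G_{n-1}(h)` already empty, it would have become so at an
  -- earlier round with champion `h`, where the run would have stopped.
  have hjump : n = 0 ∨ R.G n h ω ≠ R.G (n - 1) h ω := by
    rcases Nat.eq_zero_or_pos n with h0 | hpos
    · exact Or.inl h0
    · refine Or.inr fun e => ?_
      rw [hG] at e
      obtain ⟨s, h1, h2, h3, h4⟩ := exists_champ_of_activeSet_eq_empty M b c α δ _ _ _ h e.symm
      have h5 : R.tau ω ≤ s := R.tau_le h1 (by rw [h3]; exact h4)
      rw [hτ] at h5
      have : n ≤ s := by exact_mod_cast h5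
      omega
  obtain ⟨len, T, hT0, hTl, hT⟩ := exists_transition_times hanti n hjump
  refine mem_iUnion.2 ⟨⟨len, fun k => R.G (T k) h ω, ?_, ?_, ?_⟩, n, hτ, hc, hG,
    fun k => T k, ?_, ?_, ?_, ?_⟩
  · simp only [Fin.val_zero, hT0]
    exact activeSet_zero M b c α δ _ _ _ h
  · simp only [Fin.val_last, hTl, hG]
  · exact Fin.strictAnti_iff_succ_lt.2 fun k => (hT k k.2).2.1
  · exact Fin.strictMono_iff_lt_succ.2 fun k => (hT k k.2).1
  · simp [hT0]
  · simp [hTl]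
  · intro k t h1 h2
    exact (hT k k.2).2.2 t h1 h2

/-- On the crude good event, the run stops as soon as the threshold is below the evidence. -/
theorem tau_le_of_mem_goodEvent [Finite H] (R : Run M h b c α δ μ) {κ η : ℝ} (hκ : 0 ≤ κ)
    (hD : 0 < M.Dstar h {h}ᶜ) {t : ℕ} (ht : 1 ≤ t) (htm : mBar κ t < t)
    (hΓ : betaElim b c α δ t ≤ Gam M h κ η t) {ω : Ω} (hω : ω ∈ R.goodEvent κ η t) :
    R.tau ω ≤ t := by
  obtain ⟨hω1, hω2⟩ := hω
  set m := ⌈κ * Real.log t ^ 2⌉₊ with hm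
  have ht' : (1 : ℝ) ≤ t := by exact_mod_cast ht
  have hmb : (m : ℝ) ≤ mBar κ t := by
    have h1 := (Nat.ceil_lt_add_one (mul_nonneg hκ (sq_nonneg (Real.log t)))).le
    have h2 : Real.log t ≤ Real.log (Real.exp 1 + t) :=
      Real.log_le_log (by linarith) (by have := Real.exp_pos 1; linarith)
    have h3 : κ * Real.log t ^ 2 ≤ κ * Real.log (Real.exp 1 + t) ^ 2 :=
      mul_le_mul_of_nonneg_left (pow_le_pow_left₀ (Real.log_nonneg ht') h2 2) hκ
    rw [mBar]
    linarith
  have hmt : m ≤ t := by exact_mod_cast (hmb.trans htm.le)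
  have hchamp : ∀ r, m ≤ r → R.champ r ω = h := fun r hr => R.champ_eq_of_Tch_le hω1 hr
  refine R.tau_le ht ?_
  rw [hchamp t hmt]
  by_contra hne
  obtain ⟨g, hg⟩ := nonempty_iff_ne_empty.2 hne
  have hgh : g ≠ h := hg.1
  have hZ := hg.2 t ht le_rfl (hchamp t hmt)
  have hmart := (abs_le.1 (hω2 g hgh t le_rfl)).1
  -- Active sets decrease, so the survivor `g` belongs to the set against which each of these
  -- targets is optimal.
  have hrate : ∀ s, m ≤ s → s < t → M.Dstar h {h}ᶜ ≤ ∑ a, R.target s ω a * M.d a h g := by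
    intro s h1 h2
    have ho := R.target_oracle s ω
    rw [hchamp s h1] at ho
    exact ho.Dstar_le (activeSet_antitone M b c α δ _ _ _ h h2.le hg)
      (activeSet_subset_compl M b c α δ _ _ _ s h)
  have hsum : ((t : ℝ) - m) * M.Dstar h {h}ᶜ ≤
      ∑ a, (∑ s ∈ Finset.range t, R.target s ω a) * M.d a h g := by
    simp_rw [Finset.sum_mul]
    rw [Finset.sum_comm]
    calc ((t : ℝ) - m) * M.Dstar h {h}ᶜ = ∑ s ∈ Finset.Ico m t, M.Dstar h {h}ᶜ := by
          rw [Finset.sum_const, Nat.card_Ico, nsmul_eq_mul, Nat.cast_sub hmt]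
      _ ≤ ∑ s ∈ Finset.Ico m t, ∑ a, R.target s ω a * M.d a h g :=
          Finset.sum_le_sum fun s hs => hrate s (Finset.mem_Ico.1 hs).1 (Finset.mem_Ico.1 hs).2
      _ ≤ _ := by
          refine Finset.sum_le_sum_of_subset_of_nonneg (fun s hs => ?_) fun s _ _ =>
            Finset.sum_nonneg fun a _ =>
              mul_nonneg ((R.target_oracle s ω).1.1 a) (M.d_nonneg a h g)
          exact Finset.mem_range.2 (Finset.mem_Ico.1 hs).2
  have htrack : ∑ a, (∑ s ∈ Finset.range t, R.target s ω a) * M.d a h g -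
      M.lip h {h}ᶜ * (2 * (Fintype.card A : ℝ) ^ 2) * Real.sqrt t ≤
      ∑ a, (count (fun k => R.act k ω) t a : ℝ) * M.d a h g := by
    have h1 : ∀ a ∈ Finset.univ, (∑ s ∈ Finset.range t, R.target s ω a) * M.d a h g -
        (count (fun k => R.act k ω) t a : ℝ) * M.d a h g ≤
        2 * Fintype.card A * Real.sqrt t * M.lip h {h}ᶜ := by
      intro a _
      have h2 := (abs_le.1 (R.abs_count_sub_target_le ω ht a)).1
      rw [← sub_mul]
      exact (mul_le_mul_of_nonneg_right (by linarith) (M.d_nonneg a h g)).trans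
        (mul_le_mul_of_nonneg_left (SensingModel.d_le_lip (by simpa using hgh) a) (by positivity))
    have h3 := Finset.sum_le_card_nsmul _ _ _ h1
    rw [Finset.sum_sub_distrib, nsmul_eq_mul, Finset.card_univ] at h3
    linarith
  rw [Z_eq_sum_count_add_mart] at hZ
  have hmD := mul_le_mul_of_nonneg_left hmb hD.le
  rw [Gam] at hΓ
  linarith

/-- Needed to exchange integral and series in `Rcomp_le`; the correct event and the good events
enter only through outer measure. -/
theorem measurableSet_tau_le [Finite H] (R : Run M h b c α δ μ) (t : ℕ) :
    MeasurableSet {ω | R.tau ω ≤ t} := by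
  have hchamp : ∀ s i, MeasurableSet {ω | R.champ s ω = i} := fun s i =>
    R.ℱ.le s _ (R.measurable_champ s i)
  have hZ : ∀ s i g, Measurable fun ω =>
      Z M (fun k => R.act k ω) (fun k => R.obs k ω) s i g := by
    intro s i g
    simp_rw [Z_eq_sum_logRatio]
    exact (R.measurable_sum_comp (fun a => M.measurable_logRatio a i g) s).mono (R.ℱ.le s) le_rfl
  have hmem : ∀ s i g, MeasurableSet {ω | g ∈ R.G s i ω} := by
    intro s i g
    have e : {ω | g ∈ R.G s i ω} = {_ω | g ≠ i} ∩ ⋂ r, ⋂ (_ : 1 ≤ r), ⋂ (_ : r ≤ s),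
        ({ω | R.champ r ω = i}ᶜ ∪ {ω | Z M (fun k => R.act k ω) (fun k => R.obs k ω) r i g <
          betaElim b c α δ r}) := by
      ext ω
      simp [G, activeSet, imp_iff_not_or]
    rw [e]
    refine (MeasurableSet.const _).inter (MeasurableSet.iInter fun r => MeasurableSet.iInter
      fun _ => MeasurableSet.iInter fun _ => (hchamp r i).compl.union ?_)
    exact measurableSet_lt (hZ r i g) measurable_const
  have e : {ω | R.tau ω ≤ t} = ⋃ s, ⋃ (_ : 1 ≤ s), ⋃ (_ : s ≤ t), ⋃ i,
      ({ω | R.champ s ω = i} ∩ ⋂ g, {ω | g ∈ R.G s i ω}ᶜ) := by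
    ext ω
    simp only [mem_iUnion, mem_inter_iff, mem_iInter, mem_compl_iff, mem_ofPred_eq]
    constructor
    · intro hω
      obtain ⟨n, h1, h2, h3⟩ := R.exists_of_tau_ne_top (ne_top_of_le_ne_top (by simp) hω)
      rw [h1] at hω
      exact ⟨n, h2, by exact_mod_cast hω, _, rfl, fun g hg => by simp [h3] at hg⟩
    · rintro ⟨s, h1, h2, i, rfl, h4⟩
      exact (R.tau_le h1 (eq_empty_of_forall_notMem h4)).trans (by exact_mod_cast h2)
  rw [e]
  exact MeasurableSet.iUnion fun s => MeasurableSet.iUnion fun _ => MeasurableSet.iUnion fun _ =>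
    MeasurableSet.iUnion fun i => (hchamp s i).inter (MeasurableSet.iInter fun g =>
      (hmem s i g).compl)

end Run

/-- Layer-cake formula beyond `T`; for `N = ⊤` the series diverges. -/
theorem _root_.ENat.toENNReal_le_add_tsum (N : ℕ∞) (T : ℕ) :
    (N : ℝ≥0∞) ≤ T + ∑' t : ℕ, if N ≤ (T + t : ℕ) then 0 else 1 := by
  induction N using ENat.recTopCoe with
  | top =>
    have e : ∀ t : ℕ, (if (⊤ : ℕ∞) ≤ (T + t : ℕ) then (0 : ℝ≥0∞) else 1) = 1 := fun t =>
      if_neg (by simp)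
    simp_rw [e]
    rw [ENNReal.tsum_const_eq_top_of_ne_zero one_ne_zero]
    simp
  | coe n =>
    have h1 : ((n - T : ℕ) : ℝ≥0∞) ≤
        ∑' t : ℕ, if ((n : ℕ) : ℕ∞) ≤ (T + t : ℕ) then (0 : ℝ≥0∞) else 1 := by
      refine le_trans (le_of_eq ?_) (ENNReal.sum_le_tsum (Finset.range (n - T)))
      rw [Finset.sum_congr rfl (g := fun _ => (1 : ℝ≥0∞))]
      · simp
      · intro t ht
        have := Finset.mem_range.1 ht
        refine if_neg ?_
        rw [Nat.cast_le]
        omega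
    refine le_trans ?_ (add_le_add le_rfl h1)
    rw [ENat.toENNReal_coe]
    exact_mod_cast (by omega : n ≤ T + (n - T))

namespace Run

variable {H A O : Type*} [MeasurableSpace O] [Fintype A] [DecidableEq A]
  {M : SensingModel H A O} {h : H} {b c α δ : ℝ} {Ω : Type*} [MeasurableSpace Ω] {μ : Measure Ω}

/-- The restriction to the complement of the correct event is kept in the constant term and dropped
in the tails, which are dominated by bad events. The latter are indexed from `3`, hence `3 ≤ T`. -/
theorem Rcomp_le [Finite H] (R : Run M h b c α δ μ) {κ η : ℝ} {T : ℕ} (hT : 3 ≤ T)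
    (hgood : ∀ t ≥ T, ∀ ω ∈ R.goodEvent κ η t, R.tau ω ≤ t) :
    R.Rcomp ≤ T * μ R.corrEventᶜ + R.Cgood κ η := by
  classical
  have hmeas : ∀ t : ℕ, Measurable fun ω => if R.tau ω ≤ t then (0 : ℝ≥0∞) else 1 := fun t =>
    Measurable.ite (R.measurableSet_tau_le t) measurable_const measurable_const
  have h1 : R.Rcomp ≤ ∫⁻ ω in R.corrEventᶜ,
      ((T : ℝ≥0∞) + ∑' t : ℕ, if R.tau ω ≤ (T + t : ℕ) then 0 else 1) ∂μ :=
    lintegral_mono fun ω => ENat.toENNReal_le_add_tsum _ T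
  rw [lintegral_add_left measurable_const, setLIntegral_const,
    lintegral_tsum fun t => (hmeas (T + t)).aemeasurable] at h1
  refine h1.trans (add_le_add le_rfl ?_)
  have h2 : ∀ t : ℕ, ∫⁻ ω in R.corrEventᶜ, (if R.tau ω ≤ (T + t : ℕ) then (0 : ℝ≥0∞) else 1) ∂μ ≤
      μ (R.goodEvent κ η ((T - 3 + t) + 3))ᶜ := by
    intro t
    rw [show T - 3 + t + 3 = T + t by omega]
    refine (setLIntegral_le_lintegral _ _).trans ?_
    have e : (fun ω => if R.tau ω ≤ (T + t : ℕ) then (0 : ℝ≥0∞) else 1) =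
        {ω | R.tau ω ≤ (T + t : ℕ)}ᶜ.indicator 1 := by
      ext ω
      by_cases hω : R.tau ω ≤ (T + t : ℕ) <;>
        simp only [indicator, mem_compl_iff, mem_ofPred_eq, hω, not_true, not_false_iff, if_true,
          if_false, Pi.one_apply]
    rw [e, lintegral_indicator_one (R.measurableSet_tau_le _).compl]
    exact measure_mono (compl_subset_compl.2 (hgood (T + t) (by omega)))
  refine (ENNReal.tsum_le_tsum h2).trans ?_
  exact ENNReal.tsum_comp_le_tsum_of_injective (f := fun t : ℕ => T - 3 + t)
    (add_right_injective _) (fun t => μ (R.goodEvent κ η (t + 3))ᶜ)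

/-- A run that never stops lies in every late bad event, and summability sends their probabilities
to zero. -/
theorem measure_tau_eq_top [Finite H] (R : Run M h b c α δ μ) {κ η : ℝ} {T : ℕ}
    (hgood : ∀ t ≥ T, ∀ ω ∈ R.goodEvent κ η t, R.tau ω ≤ t) (hC : R.Cgood κ η ≠ ⊤) :
    μ {ω | R.tau ω = ⊤} = 0 := by
  have h1 : Tendsto (fun t => μ (R.goodEvent κ η (t + 3))ᶜ) atTop (nhds 0) :=
    ENNReal.tendsto_atTop_zero_of_tsum_ne_top hC
  refine le_antisymm (ge_of_tendsto h1 ?_) zero_le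
  filter_upwards [eventually_ge_atTop T] with t ht
  refine measure_mono fun ω hω hg => ?_
  have h2 := hgood (t + 3) (by omega) ω hg
  rw [show R.tau ω = ⊤ from hω] at h2
  exact absurd h2 (by simp)

/-- If the output is `i ≠ h`, then `i` has eliminated `h`, so `Z_s(i,h) ≥ α log(1/δ)` at some `s`;
the bound is `|H| δ^α`. -/
theorem measure_corrEvent_compl_le [Fintype H] [Nontrivial H] [IsProbabilityMeasure μ]
    (R : Run M h b c α δ μ) (hb : 0 ≤ b) (hc : 0 ≤ c) (htop : μ {ω | R.tau ω = ⊤} = 0) :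
    μ R.corrEventᶜ ≤
      ENNReal.ofReal (Fintype.card H * Real.exp (-(α * Real.log (1 / δ)))) := by
  have hsubset : R.corrEventᶜ ⊆ {ω | R.tau ω = ⊤} ∪ ⋃ i : H, {ω | ∃ t, α * Real.log (1 / δ) ≤
      Z M (fun k => R.act k ω) (fun k => R.obs k ω) t i h} := by
    intro ω hω
    by_cases hτ : R.tau ω = ⊤
    · exact Or.inl hτ
    right
    obtain ⟨n, h1, _, h3⟩ := R.exists_of_tau_ne_top hτ
    have hne : R.champ n ω ≠ h := fun e => hω (R.mem_corrEvent h1 h3 e)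
    have hmem : h ∉ R.G n (R.champ n ω) ω := by simp [h3]
    simp only [G, activeSet, mem_ofPred_eq, not_and, not_forall, not_lt] at hmem
    obtain ⟨s, hs1, _, _, hs⟩ := hmem hne.symm
    refine mem_iUnion.2 ⟨R.champ n ω, s, le_trans ?_ hs⟩
    have := mul_nonneg hb (Real.log_nonneg (by exact_mod_cast hs1 : (1 : ℝ) ≤ s))
    rw [betaElim]
    linarith
  refine (measure_mono hsubset).trans ((measure_union_le _ _).trans ?_)
  rw [htop, zero_add, ENNReal.ofReal_mul (Nat.cast_nonneg _), ENNReal.ofReal_natCast]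
  refine (measure_iUnion_fintype_le _ _).trans ?_
  refine (Finset.sum_le_card_nsmul _ _ _ fun i _ => R.measure_exists_le_Z_le i _).trans ?_
  rw [nsmul_eq_mul, Finset.card_univ]

end Run

end ElimTaS

namespace ElimTaS

/-! ### The crude certificate -/

section Certificate

variable {H A O : Type*} [MeasurableSpace O] [Fintype A] {M : SensingModel H A O} {h : H}

/-- The last two terms of `Γ` are nonpositive. This yields the warm-up inequality at every relevant
`t`, whereas `Twarm` only provides it at one time. -/
theorem mBar_lt_of_Gam_pos [Finite H] (hD : 0 < M.Dstar h {h}ᶜ) {κ η : ℝ} (hη : 0 ≤ η) {t : ℕ}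
    (ht : 0 < Gam M h κ η t) : mBar κ t < t := by
  have h1 : 0 ≤ M.lip h {h}ᶜ :=
    Real.iSup_nonneg fun g => Real.iSup_nonneg fun a => M.d_nonneg a h g
  have h2 : 0 ≤ M.lip h {h}ᶜ * (2 * (Fintype.card A : ℝ) ^ 2) * Real.sqrt t := by positivity
  have h3 : 0 ≤ η * Real.sqrt (t * Real.log (Real.exp 1 + t)) := by positivity
  rw [Gam] at ht
  nlinarith

theorem betaElim_pos {b c α δ : ℝ} (hb : 0 < b) (hc : 0 < c) (hα : 0 < α)
    (hδ : δ ∈ Ioo (0 : ℝ) 1) {t : ℕ} (ht : 1 ≤ t) : 0 < betaElim b c α δ t := by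
  have h1 : 0 ≤ Real.log (1 / δ) := Real.log_nonneg (by
    rw [le_div_iff₀ hδ.1]; linarith [hδ.2])
  have h2 : 0 ≤ Real.log t := Real.log_nonneg (by exact_mod_cast ht)
  unfold betaElim
  positivity

/-- The evidence grows linearly. -/
theorem exists_forall_le_Gam (hD : 0 < M.Dstar h {h}ᶜ) (κ η b c : ℝ) (hb : 0 ≤ b) :
    ∃ T : ℕ, ∀ t ≥ T, M.Dstar h {h}ᶜ / 2 * t + (b * Real.log t + c) ≤ Gam M h κ η t := by
  set D := M.Dstar h {h}ᶜ with hDdef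
  set P := M.lip h {h}ᶜ * (2 * (Fintype.card A : ℝ) ^ 2) with hP
  have hy : Tendsto (fun t : ℕ => Real.exp 1 + (t : ℝ)) atTop atTop :=
    tendsto_atTop_add_const_left _ _ tendsto_natCast_atTop_atTop
  set C₁ := c + D + 2 * P ^ 2 / D + (b + 2 * η ^ 2 / D) with hC₁
  set C₂ := D * κ + (b + 2 * η ^ 2 / D) with hC₂
  have h1 : (fun t : ℕ => Real.log (Real.exp 1 + t) ^ 2) =o[atTop] fun t : ℕ => (t : ℝ) := by
    have h2 := (Real.isLittleO_pow_log_id_atTop (n := 2)).comp_tendsto hy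
    refine h2.trans_isBigO (Asymptotics.IsBigO.of_bound 2 ?_)
    filter_upwards [eventually_ge_atTop 3] with t ht
    have ht' : (3 : ℝ) ≤ t := by exact_mod_cast ht
    have := Real.exp_one_lt_d9
    have := Real.exp_pos 1
    simp only [Function.comp, id]
    rw [Real.norm_of_nonneg (by positivity), Real.norm_of_nonneg (by positivity)]
    linarith
  have h2 : (fun _ : ℕ => C₁) =o[atTop] fun t : ℕ => (t : ℝ) :=
    Asymptotics.isLittleO_const_left.2
      (Or.inr (tendsto_norm_atTop_atTop.comp tendsto_natCast_atTop_atTop))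
  -- The slack `D t / 2` is spent as `D t / 4` on `C₁ + C₂ L²` and `D t / 8` on each of the two
  -- square-root terms, through `amgm`.
  have h3 := (h2.add (h1.const_mul_left C₂)).bound (c := D / 4) (by positivity)
  obtain ⟨T, hT⟩ := eventually_atTop.1 h3
  refine ⟨max T 1, fun t ht => ?_⟩
  have ht1 : (1 : ℝ) ≤ t := by exact_mod_cast (le_max_right T 1).trans ht
  have h4 := (le_abs_self _).trans (hT t ((le_max_left T 1).trans ht))
  rw [Real.norm_of_nonneg (by linarith)] at h4
  set L := Real.log (Real.exp 1 + t) with hL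
  have hLt : Real.log t ≤ L :=
    Real.log_le_log (by linarith) (by have := Real.exp_pos 1; linarith)
  have hL0 : 0 ≤ L := (Real.log_nonneg ht1).trans hLt
  have hL1 : L ≤ 1 + L ^ 2 := by nlinarith [sq_nonneg (L - 1)]
  have amgm : ∀ p x y : ℝ, p * (x * y) ≤ D / 8 * x ^ 2 + 2 * p ^ 2 / D * y ^ 2 := by
    intro p x y
    have : D / 8 * x ^ 2 + 2 * p ^ 2 / D * y ^ 2 - p * (x * y) =
        (D * x - 4 * p * y) ^ 2 / (8 * D) := by
      field_simp
      ring
    have : 0 ≤ (D * x - 4 * p * y) ^ 2 / (8 * D) := by positivity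
    linarith
  have h5 := amgm P (Real.sqrt t) 1
  have h6 := amgm η (Real.sqrt t) (Real.sqrt L)
  rw [Real.sq_sqrt (by linarith)] at h5 h6
  rw [Real.sq_sqrt hL0, ← Real.sqrt_mul (by linarith)] at h6
  have h7 : (b + 2 * η ^ 2 / D) * L ≤ (b + 2 * η ^ 2 / D) * (1 + L ^ 2) :=
    mul_le_mul_of_nonneg_left hL1 (by positivity)
  have h8 := mul_le_mul_of_nonneg_left hLt hb
  rw [Gam, mBar, ← hL, ← hP, ← hDdef]
  rw [hC₁, hC₂] at h4
  linarith

theorem exists_Ttilde_eq [Finite H] (hD : 0 < M.Dstar h {h}ᶜ) {b c α δ κ η : ℝ} (hη : 0 ≤ η)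
    (hb : 0 < b) (hc : 0 < c) (hα : 0 < α) (hδ : δ ∈ Ioo (0 : ℝ) 1)
    (hfin : Ttilde M h b c α δ κ η ≠ ⊤) :
    ∃ T : ℕ, Ttilde M h b c α δ κ η = T ∧ 3 ≤ T ∧
      ∀ t ≥ T, betaElim b c α δ t ≤ Gam M h κ η t := by
  have hne : ((fun n : ℕ => (n : ℕ∞)) '' {T : ℕ | Twarm κ ≤ T ∧
      ∀ t ≥ T, betaElim b c α δ t ≤ Gam M h κ η t}).Nonempty := by
    by_contra hcon
    rw [not_nonempty_iff_eq_empty] at hcon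
    exact hfin (by rw [Ttilde, hcon, sInf_empty])
  obtain ⟨T, ⟨hT1, hT2⟩, e⟩ := csInf_mem hne
  refine ⟨T, e.symm, le_trans ?_ hT1, hT2⟩
  -- The infimum of an empty set of naturals is `0`, so `3 ≤ Twarm κ` requires a warm-up time to
  -- exist; positivity of `Γ` provides one.
  have hpos : 0 < Gam M h κ η (max T 3) :=
    (betaElim_pos hb hc hα hδ (le_trans (by norm_num) (le_max_right T 3))).trans_le
      (hT2 _ (le_max_left T 3))
  have hwarm : {t : ℕ | 3 ≤ t ∧ mBar κ t ≤ t}.Nonempty :=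
    ⟨max T 3, le_max_right T 3, (mBar_lt_of_Gam_pos hD hη hpos).le⟩
  exact (Nat.sInf_mem hwarm).1

/-- The spare slope `D/2` pays for `log(1/δ)` after `(2/D) log(1/δ)` rounds; `α ≤ 1` makes the
constant independent of `α`. -/
theorem exists_Ttilde_le (hD : 0 < M.Dstar h {h}ᶜ) (κ η b c : ℝ) (hb : 0 ≤ b) :
    ∃ K : ℝ, 0 < K ∧ ∀ α ∈ Ioc (0 : ℝ) 1, ∀ δ ∈ Ioo (0 : ℝ) 1,
      (Ttilde M h b c α δ κ η : ℝ≥0∞) ≤ ENNReal.ofReal (K * (1 + Real.log (1 / δ))) := by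
  obtain ⟨T₁, hT₁⟩ := exists_forall_le_Gam hD κ η b c hb
  set D := M.Dstar h {h}ᶜ
  refine ⟨T₁ + Twarm κ + 1 + 2 / D, by positivity, fun α hα δ hδ => ?_⟩
  set l := Real.log (1 / δ) with hl
  have hl0 : 0 ≤ l := Real.log_nonneg (by rw [le_div_iff₀ hδ.1]; linarith [hδ.2])
  set T := T₁ + Twarm κ + ⌈2 / D * l⌉₊ with hT
  have hmem : T ∈ {T : ℕ | Twarm κ ≤ T ∧ ∀ t ≥ T, betaElim b c α δ t ≤ Gam M h κ η t} := by
    refine ⟨by omega, fun t ht => le_trans ?_ (hT₁ t (by omega))⟩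
    have h1 : 2 / D * l ≤ t := (Nat.le_ceil _).trans (by exact_mod_cast (by omega))
    have h2 : l ≤ D / 2 * t := by
      have := mul_le_mul_of_nonneg_left h1 (half_pos hD).le
      rwa [← mul_assoc, show D / 2 * (2 / D) = 1 by field_simp, one_mul] at this
    have h3 : α * l ≤ l := mul_le_of_le_one_left hl0 hα.2
    rw [betaElim]
    linarith
  have h1 : Ttilde M h b c α δ κ η ≤ T := sInf_le ⟨T, hmem, rfl⟩
  have h2 : (Ttilde M h b c α δ κ η : ℝ≥0∞) ≤ (T : ℝ≥0∞) := by
    simpa using ENat.toENNReal_le.2 h1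
  refine h2.trans ?_
  rw [← ENNReal.ofReal_natCast]
  refine ENNReal.ofReal_le_ofReal ?_
  have h3 := (Nat.ceil_lt_add_one (by positivity : 0 ≤ 2 / D * l)).le
  have h4 : 0 ≤ ((T₁ : ℝ) + Twarm κ + 1) * l := by positivity
  have h5 : 0 ≤ 2 / D := by positivity
  rw [hT]
  push_cast
  linarith

end Certificate

/-! ### Uniform bounds for the residual term -/

/-- A bound on `∑_t Pr(G_t^c)` for all runs whose champion is wrong with probability at most
`B exp (-r √t)` in round `t`, where `B = |H| exp (2 r |A|)`. -/
noncomputable def goodConst (H A : Type*) [Fintype H] [Fintype A] (r : ℝ) : ℝ :=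
  ∑' t : ℕ, (Fintype.card H * Real.exp (2 * r * Fintype.card A) *
    (∑' k : ℕ, Real.exp (-(r / 2 * Real.sqrt k))) + 2 * Fintype.card H) *
      (1 / ((t + 3 : ℕ) : ℝ) ^ 2)

theorem goodConst_nonneg (H A : Type*) [Fintype H] [Fintype A] (r : ℝ) : 0 ≤ goodConst H A r := by
  have : 0 ≤ ∑' k : ℕ, Real.exp (-(r / 2 * Real.sqrt k)) := tsum_nonneg fun _ => (Real.exp_pos _).le
  exact tsum_nonneg fun t => by positivity

/-- With `l = log(1/δ)`, the linear growth of the certificate is absorbed by the error probability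
`δ^α`, at a cost of order `1/α`. -/
theorem one_add_mul_exp_neg_le {α l : ℝ} (hα : 0 < α) (hl : 0 ≤ l) :
    (1 + l) * Real.exp (-(α * l)) ≤ 1 + 1 / α := by
  rw [Real.exp_neg, ← div_eq_mul_inv, div_le_iff₀ (Real.exp_pos _)]
  have h1 := Real.add_one_le_exp (α * l)
  have h2 : 0 ≤ α * l := by positivity
  have h3 : l = 1 / α * (α * l) := by field_simp
  have h4 : 0 < 1 / α := by positivity
  calc 1 + l = 1 + 1 / α * (α * l) := by rw [← h3]
    _ ≤ Real.exp (α * l) + 1 / α * Real.exp (α * l) :=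
      add_le_add (by linarith) (mul_le_mul_of_nonneg_left (by linarith) h4.le)
    _ = _ := by ring

namespace Run

variable {H A O : Type*} [Fintype H] [Fintype A] [DecidableEq A] [MeasurableSpace O]
  {M : SensingModel H A O} {h : H} {v : ℝ≥0} {b c α δ κ η : ℝ} {Ω : Type*} [MeasurableSpace Ω]
  {μ : Measure Ω}

/-- The crude good events fail with summable probabilities, uniformly over all runs. -/
theorem Cgood_le [IsProbabilityMeasure μ] (R : Run M h b c α δ μ) (hM : M.Identifiable) (hv : 0 < v)
    (hsub : M.SubGaussian h v) {m : ℝ} (hm : 0 < m)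
    (hmd : ∀ a g, 0 < M.d a h g → m ≤ M.d a h g) (hκ : 16 / (m ^ 2 / (2 * v)) ^ 2 ≤ κ)
    (hη : Real.sqrt (10 * v) ≤ η) :
    R.Cgood κ η ≤ ENNReal.ofReal (goodConst H A (m ^ 2 / (2 * v))) := by
  have hv' : (0 : ℝ) < v := by exact_mod_cast hv
  set r : ℝ := m ^ 2 / (2 * v) with hr
  have hr0 : 0 < r := by positivity
  set B : ℝ := Fintype.card H * Real.exp (2 * r * Fintype.card A) with hB
  have hB0 : 0 ≤ B := by positivity
  have hS : 0 ≤ ∑' k : ℕ, Real.exp (-(r / 2 * Real.sqrt k)) :=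
    tsum_nonneg fun _ => (Real.exp_pos _).le
  have hchamp : ∀ t, μ {ω | R.champ t ω ≠ h} ≤
      ENNReal.ofReal (B * Real.exp (-(r * Real.sqrt t))) := by
    intro t
    refine (R.measure_champ_ne_le hM hsub hv hm hmd t).trans (le_of_eq ?_)
    rw [hB, mul_assoc, ← Real.exp_add, ← hr]
    congr 3
    ring
  rw [goodConst, ENNReal.ofReal_tsum_of_nonneg (fun t => by positivity)
    (((summable_nat_add_iff 3).2
      (Real.summable_one_div_nat_pow.2 (by norm_num : 1 < 2))).mul_left _)]
  exact ENNReal.tsum_le_tsum fun t =>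
    R.measure_goodEvent_compl_le hsub hv hB0 hr0 hchamp hκ hη (by omega)

theorem tau_le_of_betaElim_le_Gam (R : Run M h b c α δ μ) (hD : 0 < M.Dstar h {h}ᶜ) (hκ : 0 ≤ κ)
    (hη : 0 ≤ η) (hb : 0 < b) (hc : 0 < c) (hα : 0 < α) (hδ : δ ∈ Ioo (0 : ℝ) 1) {T : ℕ}
    (hT3 : 3 ≤ T) (hT : ∀ t ≥ T, betaElim b c α δ t ≤ Gam M h κ η t) :
    ∀ t ≥ T, ∀ ω ∈ R.goodEvent κ η t, R.tau ω ≤ t := by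
  intro t ht ω hω
  have ht1 : 1 ≤ t := by omega
  exact R.tau_le_of_mem_goodEvent hκ hD ht1
    (mBar_lt_of_Gam_pos hD hη ((betaElim_pos hb hc hα hδ ht1).trans_le (hT t ht))) (hT t ht) hω

theorem Rcomp_le_Ttilde_mul_add (R : Run M h b c α δ μ) (hD : 0 < M.Dstar h {h}ᶜ) (hκ : 0 ≤ κ)
    (hη : 0 ≤ η) (hb : 0 < b) (hc : 0 < c) (hα : 0 < α) (hδ : δ ∈ Ioo (0 : ℝ) 1)
    (hfin : Ttilde M h b c α δ κ η ≠ ⊤) :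
    R.Rcomp ≤ (Ttilde M h b c α δ κ η : ℝ≥0∞) * μ R.corrEventᶜ + R.Cgood κ η := by
  obtain ⟨T, e, hT3, hT⟩ := exists_Ttilde_eq hD hη hb hc hα hδ hfin
  rw [e, ENat.toENNReal_coe]
  exact R.Rcomp_le hT3 (R.tau_le_of_betaElim_le_Gam hD hκ hη hb hc hα hδ hT3 hT)

theorem measure_corrEvent_compl_le_of_Cgood_ne_top [Nontrivial H] [IsProbabilityMeasure μ]
    (R : Run M h b c α δ μ) (hD : 0 < M.Dstar h {h}ᶜ) (hκ : 0 ≤ κ) (hη : 0 ≤ η) (hb : 0 < b) (hc : 0 < c) (hα : 0 < α)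
    (hδ : δ ∈ Ioo (0 : ℝ) 1) (hfin : Ttilde M h b c α δ κ η ≠ ⊤) (hC : R.Cgood κ η ≠ ⊤) :
    μ R.corrEventᶜ ≤
      ENNReal.ofReal (Fintype.card H * Real.exp (-(α * Real.log (1 / δ)))) := by
  obtain ⟨T, -, hT3, hT⟩ := exists_Ttilde_eq hD hη hb hc hα hδ hfin
  exact R.measure_corrEvent_compl_le hb.le hc.le (R.measure_tau_eq_top
    (R.tau_le_of_betaElim_le_Gam hD hκ hη hb hc hα hδ hT3 hT) hC)

/-- The residual term is bounded uniformly in the confidence level. -/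
theorem Rcomp_le_ofReal [Nontrivial H] [IsProbabilityMeasure μ] (R : Run M h b c α δ μ)
    (hD : 0 < M.Dstar h {h}ᶜ) (hκ : 0 ≤ κ) (hη : 0 ≤ η) (hb : 0 < b) (hc : 0 < c) (hα : 0 < α)
    (hδ : δ ∈ Ioo (0 : ℝ) 1) {K C : ℝ} (hK : 0 ≤ K) (hC : 0 ≤ C) (hCgood : R.Cgood κ η ≤ ENNReal.ofReal C)
    (hT : (Ttilde M h b c α δ κ η : ℝ≥0∞) ≤ ENNReal.ofReal (K * (1 + Real.log (1 / δ)))) :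
    R.Rcomp ≤ ENNReal.ofReal (K * Fintype.card H * (1 + 1 / α) + C) := by
  have hfin : Ttilde M h b c α δ κ η ≠ ⊤ := fun e => by simp [e] at hT
  have hl : 0 ≤ Real.log (1 / δ) :=
    Real.log_nonneg (by rw [le_div_iff₀ hδ.1]; linarith [hδ.2])
  have h1 := R.measure_corrEvent_compl_le_of_Cgood_ne_top hD hκ hη hb hc hα hδ hfin
    (ne_top_of_le_ne_top ENNReal.ofReal_ne_top hCgood)
  refine (R.Rcomp_le_Ttilde_mul_add hD hκ hη hb hc hα hδ hfin).trans ?_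
  rw [ENNReal.ofReal_add (by positivity) hC]
  refine add_le_add ((mul_le_mul' hT h1).trans ?_) hCgood
  rw [← ENNReal.ofReal_mul (by positivity)]
  refine ENNReal.ofReal_le_ofReal ?_
  have h2 := mul_le_mul_of_nonneg_left (one_add_mul_exp_neg_le hα hl)
    (by positivity : 0 ≤ K * Fintype.card H)
  linarith

end Run

end ElimTaS

/-! ### The proposition -/

theorem mainTheorem6 {H A O : Type*} [Finite H] [Nontrivial H] [Fintype A] [DecidableEq A]
    [MeasurableSpace O] (M : ElimTaS.SensingModel H A O) (hM : M.Identifiable)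
    (h : H) (v : ℝ≥0) (hv : 0 < v) (hsub : M.SubGaussian h v) :
    ∃ κ₀ : ℝ, 0 < κ₀ ∧ ∀ κ η b c : ℝ, κ₀ ≤ κ → Real.sqrt (10 * v) ≤ η → 0 < b → 0 < c →
      ∃ K C : ℝ, 0 < K ∧ ∀ α ∈ Set.Ioc (0 : ℝ) 1,
        (∀ δ ∈ Set.Ioo (0 : ℝ) 1,
          (ElimTaS.Ttilde M h b c α δ κ η : ℝ≥0∞) ≤
              ENNReal.ofReal (K * (1 + Real.log (1 / δ))) ∧
            ∀ (Ω : Type*) [MeasurableSpace Ω] (μ : Measure Ω) [IsProbabilityMeasure μ]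
              (R : ElimTaS.Run M h b c α δ μ),
              R.Cgood κ η ≤ ENNReal.ofReal C ∧
              R.Rcomp ≤ (ElimTaS.Ttilde M h b c α δ κ η : ℝ≥0∞) * μ R.corrEventᶜ
                + R.Cgood κ η) ∧
        ∃ Rbar : ℝ, ∀ δ ∈ Set.Ioo (0 : ℝ) 1,
          ∀ (Ω : Type*) [MeasurableSpace Ω] (μ : Measure Ω) [IsProbabilityMeasure μ]
            (R : ElimTaS.Run M h b c α δ μ),
            R.Rcomp ≤ ENNReal.ofReal Rbar := by
  have := Fintype.ofFinite H
  have hD := hM.Dstar_pos h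
  obtain ⟨m, hm, hmd'⟩ := ElimTaS.exists_pos_forall_le_of_pos fun q : A × H => M.d q.1 h q.2
  have hmd : ∀ a g, 0 < M.d a h g → m ≤ M.d a h g := fun a g => hmd' (a, g)
  have hv' : (0 : ℝ) < v := by exact_mod_cast hv
  -- `κ₀ = 16/r²` with `r = m²/(2v)`, as `measure_goodEvent_compl_le` requires.
  refine ⟨16 / (m ^ 2 / (2 * v)) ^ 2, by positivity, fun κ η b c hκ hη hb hc => ?_⟩
  have hκ0 : 0 ≤ κ := le_trans (by positivity) hκ
  have hη0 : 0 ≤ η := (Real.sqrt_nonneg _).trans hη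
  obtain ⟨K, hK, hT⟩ := ElimTaS.exists_Ttilde_le hD κ η b c hb.le
  refine ⟨K, ElimTaS.goodConst H A (m ^ 2 / (2 * v)), hK, fun α hα => ⟨fun δ hδ =>
    ⟨hT α hα δ hδ, fun Ω _ μ _ R => ⟨R.Cgood_le hM hv hsub hm hmd hκ hη, ?_⟩⟩,
    K * Fintype.card H * (1 + 1 / α) + ElimTaS.goodConst H A (m ^ 2 / (2 * v)),
    fun δ hδ Ω _ μ _ R => ?_⟩⟩
  · refine R.Rcomp_le_Ttilde_mul_add hD hκ0 hη0 hb hc hα.1 hδ fun e => ?_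
    have := hT α hα δ hδ
    simp [e] at this
  · exact R.Rcomp_le_ofReal hD hκ0 hη0 hb hc hα.1 hδ hK.le (ElimTaS.goodConst_nonneg H A _)
      (R.Cgood_le hM hv hsub hm hmd hκ hη) (hT α hα δ hδ)
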